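/- Let $n\ge 2$. Let $\mathcal S_0(\mathbb R^n)$ be the space of Lizorkin test functions, i.e. the functions $\varphi$ in the Schwartz space $\mathcal S(\mathbb R^n)$ with $\int_{\mathbb R^n}x^m\varphi(x)\,dx=0$ for all $m\in\mathbb N_0^n$, with the topology induced by $\mathcal S(\mathbb R^n)$; $\mathcal S_0(\mathbb R)$ is defined in the same way. Let $\mathbb R_+=(0,\infty)$ and $\mathbb Y^{n+1}=\mathbb S^{n-1}\times\mathbb R\times\mathbb R_+$, with points $(u,b,a)$, where $\mathbb S^{n-1}$ is the unit sphere of $\mathbb R^n$. Let $\mathcal S(\mathbb Y^{n+1})$ be the space of all $\Phi\in C^\infty(\mathbb Y^{n+1})$ (complex-valued) such that $$\rho_{s,r}^{l,m,k}(\Phi)=\sup_{(u,b,a)\in\mathbb Y^{n+1}}\Big(a^s+\frac1{a^s}\Big)(1+b^2)^{r/2}\left|\frac{\partial^l}{\partial a^l}\frac{\partial^m}{\partial b^m}\triangle_u^k\Phi(u,b,a)\right|<\infty\qquad\text{for all } l,m,k,s,r\in\mathbb N_0,$$ where $\triangle_u$ is the Laplace–Beltrami operator of $\mathbb S^{n-1}$,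 with the locally convex topology defined by the seminorms $\rho_{s,r}^{l,m,k}$. For $f\in\mathcal S_0(\mathbb R^n)$, $\psi\in\mathcal S_0(\mathbb R)$ and $(u,b,a)\in\mathbb Y^{n+1}$ let $$\mathcal R_\psi f(u,b,a)=\int_{\mathbb R^n}f(x)\,\frac1a\,\overline{\psi\Big(\frac{x\cdot u-b}{a}\Big)}\,dx .$$ Then $\mathcal R_\psi f\in\mathcal S(\mathbb Y^{n+1})$ for all such $f$ and $\psi$, and the ridgelet mapping $\mathcal R:(f,\psi)\mapsto\mathcal R_\psi f$, which is linear in $f$ and conjugate-linear in $\psi$, is (jointly) continuous from $\mathcal S_0(\mathbb R^n)\times\mathcal S_0(\mathbb R)$ into $\mathcal S(\mathbb Y^{n+1})$. -/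

import Mathlib

open scoped ContDiff Manifold SchwartzMap Laplacian

noncomputable section

namespace Ridgelet

/-! ### Lizorkin test functions -/

/-- The Lizorkin space `S₀(ℝⁿ)`: the Schwartz functions on `ℝⁿ` all of whose moments
`∫ x^m φ(x) dx`, `m ∈ ℕ₀ⁿ`, vanish. It carries the subspace topology. -/
def lizorkin (n : ℕ) : Submodule ℂ 𝓢(EuclideanSpace ℝ (Fin n), ℂ) where
  carrier := {φ | ∀ m : Fin n → ℕ, ∫ x, (∏ i, (x i : ℂ) ^ m i) * φ x = 0}
  zero_mem' := by intro m; simp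
  smul_mem' := by
    intro c φ hφ m
    have h : ∀ x : EuclideanSpace ℝ (Fin n),
        (∏ i, (x i : ℂ) ^ m i) * (c • φ) x = c * ((∏ i, (x i : ℂ) ^ m i) * φ x) := by
      intro x; simp; ring
    simp_rw [h, MeasureTheory.integral_const_mul, hφ m, mul_zero]
  add_mem' := by
    intro φ χ hφ hχ m
    have hg : (fun x : EuclideanSpace ℝ (Fin n) => ∏ i, (x i : ℂ) ^ m i).HasTemperateGrowth := by
      have h1 : ∀ i, (fun x : EuclideanSpace ℝ (Fin n) => (x i : ℂ)).HasTemperateGrowth := fun i =>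
        (Complex.ofRealCLM.comp (EuclideanSpace.proj i :
          EuclideanSpace ℝ (Fin n) →L[ℝ] ℝ)).hasTemperateGrowth
      have h2 : ∀ s : Finset (Fin n), (fun x : EuclideanSpace ℝ (Fin n) =>
          ∏ i ∈ s, (x i : ℂ) ^ m i).HasTemperateGrowth := by
        intro s
        induction s using Finset.induction_on with
        | empty => simp [Function.HasTemperateGrowth.const (1 : ℂ)]
        | insert a s ha ih =>
          simp_rw [Finset.prod_insert ha]
          exact ((h1 a).pow (m a)).mul ih
      exact h2 Finset.univ
    have hi : ∀ f : 𝓢(EuclideanSpace ℝ (Fin n), ℂ), MeasureTheory.Integrable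
        (fun x => (∏ i, (x i : ℂ) ^ m i) * f x) := by
      intro f
      have := (SchwartzMap.smulLeftCLM ℂ
        (fun x : EuclideanSpace ℝ (Fin n) => ∏ i, (x i : ℂ) ^ m i) f).integrable
        (μ := MeasureTheory.volume)
      rw [SchwartzMap.smulLeftCLM_apply hg] at this
      simpa using this
    simp only [_root_.add_apply, mul_add]
    rw [MeasureTheory.integral_add (hi φ) (hi χ), hφ m, hχ m, add_zero]

/-- The Lizorkin space `S₀(ℝ)` on the line, with the subspace topology. -/
def lizorkinLine : Submodule ℂ 𝓢(ℝ, ℂ) where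
  carrier := {ψ | ∀ m : ℕ, ∫ x : ℝ, (x : ℂ) ^ m * ψ x = 0}
  zero_mem' := by intro m; simp
  smul_mem' := by
    intro c φ hφ m
    have h : ∀ x : ℝ, (x : ℂ) ^ m * (c • φ) x = c * ((x : ℂ) ^ m * φ x) := by
      intro x; simp; ring
    simp_rw [h, MeasureTheory.integral_const_mul, hφ m, mul_zero]
  add_mem' := by
    intro φ χ hφ hχ m
    have hg : (fun x : ℝ => (x : ℂ) ^ m).HasTemperateGrowth :=
      Complex.ofRealCLM.hasTemperateGrowth.pow m
    have hi : ∀ f : 𝓢(ℝ, ℂ), MeasureTheory.Integrable (fun x : ℝ => (x : ℂ) ^ m * f x) := by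
      intro f
      have := (SchwartzMap.smulLeftCLM ℂ (fun x : ℝ => (x : ℂ) ^ m) f).integrable
        (μ := MeasureTheory.volume)
      rw [SchwartzMap.smulLeftCLM_apply hg] at this
      simpa using this
    simp only [_root_.add_apply, mul_add]
    rw [MeasureTheory.integral_add (hi φ) (hi χ), hφ m, hχ m, add_zero]

/-! ### The manifold `Y^{n+1} = S^{n-1} × ℝ × ℝ₊` and its differential operators -/

/-- The open half-line `ℝ₊ = (0, ∞)`, an open submanifold of `ℝ`. -/
def posReals : TopologicalSpace.Opens ℝ := ⟨Set.Ioi 0, isOpen_Ioi⟩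

/-- A positive number as a point of `ℝ₊`. -/
def mkPos (a : ℝ) (ha : 0 < a) : posReals := ⟨a, ha⟩

/-- The unit sphere of `ℝⁿ`. -/
abbrev USphere (n : ℕ) : Type := Metric.sphere (0 : EuclideanSpace ℝ (Fin n)) 1

/-- `Y^{n+1} = S^{n-1} × ℝ × ℝ₊`, with points `(u, b, a)`. -/
abbrev Y (n : ℕ) : Type := USphere n × ℝ × posReals

instance finrankFact (n : ℕ) [n.AtLeastTwo] :
    Fact (Module.finrank ℝ (EuclideanSpace ℝ (Fin n)) = (n - 1) + 1) :=
  ⟨by rw [finrank_euclideanSpace_fin]; have := Nat.AtLeastTwo.prop (n := n); omega⟩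

/-- `Φ ∈ C^∞(Y^{n+1})`, for the product manifold structure. -/
def IsSmooth {n : ℕ} [n.AtLeastTwo] (Φ : Y n → ℂ) : Prop :=
  ContMDiff ((𝓡 (n - 1)).prod (𝓘(ℝ, ℝ).prod 𝓘(ℝ, ℝ))) 𝓘(ℝ, ℂ) ∞ Φ

/-- The radial projection `x ↦ x / |x|` of `ℝⁿ ∖ {0}` onto the unit sphere. -/
def radialProj {n : ℕ} (x : EuclideanSpace ℝ (Fin n)) (hx : x ≠ 0) : USphere n :=
  ⟨‖x‖⁻¹ • x, by simp [norm_smul, hx]⟩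

open Classical in
/-- The extension of a function on the sphere to `ℝⁿ ∖ {0}` that is constant on rays
(value `0` at the origin). -/
def homExt {n : ℕ} (g : USphere n → ℂ) (x : EuclideanSpace ℝ (Fin n)) : ℂ :=
  if hx : x ≠ 0 then g (radialProj x hx) else 0

/-- The Laplace–Beltrami operator of the unit sphere: the Euclidean Laplacian of the extension
that is constant on rays, restricted to the sphere. -/
def laplaceBeltrami {n : ℕ} (g : USphere n → ℂ) (u : USphere n) : ℂ :=
  (Δ (homExt g)) (u : EuclideanSpace ℝ (Fin n))

/-- `Δ_u Φ`, the Laplace–Beltrami operator in the variable `u`. -/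
def opU {n : ℕ} (Φ : Y n → ℂ) : Y n → ℂ :=
  fun y => laplaceBeltrami (fun u => Φ (u, y.2.1, y.2.2)) y.1

/-- `∂Φ/∂b`. -/
def opB {n : ℕ} (Φ : Y n → ℂ) : Y n → ℂ :=
  fun y => deriv (fun b => Φ (y.1, b, y.2.2)) y.2.1

open Classical in
/-- A function on `ℝ₊` extended by `0` to `ℝ`. -/
def extPos (g : posReals → ℂ) (a : ℝ) : ℂ :=
  if ha : 0 < a then g (mkPos a ha) else 0

/-- `∂Φ/∂a`. -/
def opA {n : ℕ} (Φ : Y n → ℂ) : Y n → ℂ :=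
  fun y => deriv (extPos fun a => Φ (y.1, y.2.1, a)) (y.2.2 : ℝ)

/-- `∂_a^l ∂_b^m Δ_u^k Φ`. -/
def diffOp {n : ℕ} (l m k : ℕ) (Φ : Y n → ℂ) : Y n → ℂ :=
  opA^[l] (opB^[m] (opU^[k] Φ))

/-- `(a^s + a^{-s}) (1 + b²)^{r/2} |∂_a^l ∂_b^m Δ_u^k Φ (u, b, a)|` at the point `y = (u, b, a)`. -/
def weighted {n : ℕ} (s r l m k : ℕ) (Φ : Y n → ℂ) (y : Y n) : ℝ :=
  ((y.2.2 : ℝ) ^ s + 1 / (y.2.2 : ℝ) ^ s) * (1 + y.2.1 ^ 2) ^ ((r : ℝ) / 2) * ‖diffOp l m k Φ y‖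

/-! ### The differential operators are linear on smooth functions and preserve smoothness -/

section Smooth

variable {n : ℕ}

/-- The open set `(ℝⁿ ∖ {0}) × ℝ × ℝ₊`. -/
def amb (n : ℕ) : TopologicalSpace.Opens (EuclideanSpace ℝ (Fin n) × ℝ × ℝ) :=
  ⟨{p | p.1 ≠ 0 ∧ 0 < p.2.2},
    (isOpen_ne.preimage continuous_fst).inter
      (isOpen_Ioi.preimage (continuous_snd.comp continuous_snd))⟩

/-- The inclusion of `Y^{n+1}` in the ambient space. -/
def incl (y : Y n) : EuclideanSpace ℝ (Fin n) × ℝ × ℝ := (y.1, y.2.1, y.2.2)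

open Classical in
/-- The extension of a function on `Y^{n+1}` to the ambient space. -/
def ext (Φ : Y n → ℂ) (p : EuclideanSpace ℝ (Fin n) × ℝ × ℝ) : ℂ :=
  if h : p.1 ≠ 0 ∧ 0 < p.2.2 then Φ (radialProj p.1 h.1, p.2.1, mkPos p.2.2 h.2) else 0

lemma incl_mem (y : Y n) : incl y ∈ amb n :=
  ⟨ne_zero_of_mem_unit_sphere y.1, y.2.2.2⟩

lemma radialProj_coe (u : USphere n) (h : (u : EuclideanSpace ℝ (Fin n)) ≠ 0) :
    radialProj (u : EuclideanSpace ℝ (Fin n)) h = u := by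
  ext1; simp [radialProj]

lemma ext_incl (Φ : Y n → ℂ) (y : Y n) : ext Φ (incl y) = Φ y := by
  have h : (incl y).1 ≠ 0 ∧ 0 < (incl y).2.2 := incl_mem y
  rw [ext, dif_pos h]
  congr 1
  exact Prod.ext (radialProj_coe y.1 h.1) rfl

lemma ext_smooth [n.AtLeastTwo] {Φ : Y n → ℂ} (h : IsSmooth Φ) :
    ContDiffOn ℝ ∞ (ext Φ) (amb n) := by
  intro p hp
  apply ContDiffAt.contDiffWithinAt
  rw [← contMDiffAt_iff_contDiffAt]
  have key := contMDiffAt_subtype_iff (I := 𝓘(ℝ, EuclideanSpace ℝ (Fin n) × ℝ × ℝ))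
    (I' := 𝓘(ℝ, ℂ)) (n := ∞) (U := amb n) (f := ext Φ) (x := ⟨p, hp⟩)
  refine key.mp ?_
  have heq : (fun x : amb n => ext Φ x) = Φ ∘ fun x : amb n =>
      (radialProj x.1.1 x.2.1, x.1.2.1, mkPos x.1.2.2 x.2.2) := by
    funext x
    exact dif_pos x.2
  rw [heq]
  have hval : ContMDiff 𝓘(ℝ, EuclideanSpace ℝ (Fin n) × ℝ × ℝ)
      𝓘(ℝ, EuclideanSpace ℝ (Fin n) × ℝ × ℝ) ∞ (Subtype.val : amb n → _) :=
    contMDiff_subtype_val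
  have comp : ∀ {F : Type} [NormedAddCommGroup F] [NormedSpace ℝ F]
      (g : EuclideanSpace ℝ (Fin n) × ℝ × ℝ → F), ContDiffOn ℝ ∞ g (amb n) →
      ContMDiff 𝓘(ℝ, EuclideanSpace ℝ (Fin n) × ℝ × ℝ) 𝓘(ℝ, F) ∞ (fun x : amb n => g x) := by
    intro F _ _ g hg
    exact hg.contMDiffOn.comp_contMDiff hval (fun x => x.2)
  refine ContMDiff.contMDiffAt (ContMDiff.comp h ?_)
  refine ContMDiff.prodMk ?_ (ContMDiff.prodMk ?_ ?_)
  · refine ContMDiff.codRestrict_sphere (n := n - 1)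
      (f := fun x : amb n => ‖x.1.1‖⁻¹ • x.1.1) ?_ _
    refine comp (fun x => ‖x.1‖⁻¹ • x.1) ?_
    intro x hx
    have h0 : x.1 ≠ 0 := hx.1
    exact ((((contDiffAt_norm ℝ h0).comp x contDiffAt_fst).inv (norm_ne_zero_iff.mpr h0)).smul
      contDiffAt_fst).contDiffWithinAt
  · exact comp (fun x => x.2.1) (contDiff_fst.comp contDiff_snd).contDiffOn
  · rw [← ContMDiff.subtypeVal_comp_iff]
    exact comp (fun x => x.2.2) (contDiff_snd.comp contDiff_snd).contDiffOn

lemma incl_smooth [n.AtLeastTwo] :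
    ContMDiff ((𝓡 (n - 1)).prod (𝓘(ℝ, ℝ).prod 𝓘(ℝ, ℝ)))
      𝓘(ℝ, EuclideanSpace ℝ (Fin n) × ℝ × ℝ) ∞ (incl : Y n → _) := by
  have h1 : ContMDiff ((𝓡 (n - 1)).prod (𝓘(ℝ, ℝ).prod 𝓘(ℝ, ℝ)))
      𝓘(ℝ, EuclideanSpace ℝ (Fin n)) ∞ (fun y : Y n => (y.1 : EuclideanSpace ℝ (Fin n))) :=
    (contMDiff_coe_sphere (n := n - 1)).comp contMDiff_fst
  have h2 : ContMDiff ((𝓡 (n - 1)).prod (𝓘(ℝ, ℝ).prod 𝓘(ℝ, ℝ)))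
      𝓘(ℝ, ℝ) ∞ (fun y : Y n => y.2.1) := contMDiff_fst.comp contMDiff_snd
  have h3 : ContMDiff ((𝓡 (n - 1)).prod (𝓘(ℝ, ℝ).prod 𝓘(ℝ, ℝ)))
      𝓘(ℝ, ℝ) ∞ (fun y : Y n => (y.2.2 : ℝ)) :=
    contMDiff_subtype_val.comp (contMDiff_snd.comp contMDiff_snd)
  exact h1.prodMk_space (h2.prodMk_space h3)

lemma smooth_of_ambient [n.AtLeastTwo] {G : EuclideanSpace ℝ (Fin n) × ℝ × ℝ → ℂ}
    (hG : ContDiffOn ℝ ∞ G (amb n)) : IsSmooth (fun y : Y n => G (incl y)) :=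
  hG.contMDiffOn.comp_contMDiff incl_smooth incl_mem

/-- The derivative of `G` in the direction `v`. -/
def dirD (v : EuclideanSpace ℝ (Fin n) × ℝ × ℝ) (G : EuclideanSpace ℝ (Fin n) × ℝ × ℝ → ℂ) :
    EuclideanSpace ℝ (Fin n) × ℝ × ℝ → ℂ := fun p => fderiv ℝ G p v

lemma dirD_smooth (v : EuclideanSpace ℝ (Fin n) × ℝ × ℝ)
    {G : EuclideanSpace ℝ (Fin n) × ℝ × ℝ → ℂ} (hG : ContDiffOn ℝ ∞ G (amb n)) :
    ContDiffOn ℝ ∞ (dirD v G) (amb n) :=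
  (hG.fderiv_of_isOpen (amb n).2 (m := ∞) (by simp)).clm_apply contDiffOn_const

lemma diffAt {G : EuclideanSpace ℝ (Fin n) × ℝ × ℝ → ℂ} (hG : ContDiffOn ℝ ∞ G (amb n))
    {p : EuclideanSpace ℝ (Fin n) × ℝ × ℝ} (hp : p ∈ amb n) : DifferentiableAt ℝ G p :=
  (hG.contDiffAt ((amb n).2.mem_nhds hp)).differentiableAt (by simp)

lemma opB_eq [n.AtLeastTwo] {Φ : Y n → ℂ} (h : IsSmooth Φ) (y : Y n) :
    opB Φ y = dirD (0, 1, 0) (ext Φ) (incl y) := by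
  have hd := (diffAt (ext_smooth h) (incl_mem y)).hasFDerivAt
  have hc : HasDerivAt (fun b : ℝ => ((y.1 : EuclideanSpace ℝ (Fin n)), b, (y.2.2 : ℝ)))
      (0, 1, 0) y.2.1 :=
    (hasDerivAt_const _ _).prodMk ((hasDerivAt_id _).prodMk (hasDerivAt_const _ _))
  have := (hd.comp_hasDerivAt y.2.1 hc).deriv
  rw [dirD, ← this, opB]
  congr 1
  funext b
  exact (ext_incl Φ (y.1, b, y.2.2)).symm

lemma opA_eq [n.AtLeastTwo] {Φ : Y n → ℂ} (h : IsSmooth Φ) (y : Y n) :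
    opA Φ y = dirD (0, 0, 1) (ext Φ) (incl y) := by
  have hd := (diffAt (ext_smooth h) (incl_mem y)).hasFDerivAt
  have hc : HasDerivAt (fun a : ℝ => ((y.1 : EuclideanSpace ℝ (Fin n)), y.2.1, a))
      (0, 0, 1) (y.2.2 : ℝ) :=
    (hasDerivAt_const _ _).prodMk ((hasDerivAt_const _ _).prodMk (hasDerivAt_id _))
  have := (hd.comp_hasDerivAt (y.2.2 : ℝ) hc).deriv
  rw [dirD, ← this, opA]
  apply Filter.EventuallyEq.deriv_eq
  filter_upwards [isOpen_Ioi.mem_nhds y.2.2.2] with a ha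
  have ha' : 0 < a := ha
  rw [extPos, dif_pos ha']
  exact (ext_incl Φ (y.1, y.2.1, mkPos a ha)).symm

lemma opU_eq [n.AtLeastTwo] {Φ : Y n → ℂ} (h : IsSmooth Φ) (y : Y n) :
    opU Φ y = ∑ i, dirD (stdOrthonormalBasis ℝ (EuclideanSpace ℝ (Fin n)) i, 0, 0)
      (dirD (stdOrthonormalBasis ℝ (EuclideanSpace ℝ (Fin n)) i, 0, 0) (ext Φ)) (incl y) := by
  have hh : homExt (fun u => Φ (u, y.2.1, y.2.2)) = fun x => ext Φ (x, y.2.1, (y.2.2 : ℝ)) := by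
    funext x
    by_cases hx : x = 0
    · simp [homExt, ext, hx]
    · have hx' : x ≠ 0 ∧ (0 : ℝ) < y.2.2 := ⟨hx, y.2.2.2⟩
      rw [homExt, dif_pos hx, ext, dif_pos hx']
      rfl
  have hc : ∀ x : EuclideanSpace ℝ (Fin n),
      HasFDerivAt (fun x : EuclideanSpace ℝ (Fin n) => (x, y.2.1, (y.2.2 : ℝ)))
        (ContinuousLinearMap.inl ℝ _ _) x := fun x =>
    (hasFDerivAt_id x).prodMk (hasFDerivAt_const _ _)
  have hG : ∀ {G : EuclideanSpace ℝ (Fin n) × ℝ × ℝ → ℂ}, ContDiffOn ℝ ∞ G (amb n) →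
      ∀ x : EuclideanSpace ℝ (Fin n), x ≠ 0 → ∀ v,
      fderiv ℝ (fun x => G (x, y.2.1, (y.2.2 : ℝ))) x v =
        dirD (v, 0, 0) G (x, y.2.1, (y.2.2 : ℝ)) := by
    intro G hG x hx v
    have := ((diffAt hG (p := (x, y.2.1, (y.2.2 : ℝ))) ⟨hx, y.2.2.2⟩).hasFDerivAt.comp x
      (hc x)).fderiv
    rw [show (fun x => G (x, y.2.1, (y.2.2 : ℝ))) =
      G ∘ (fun x : EuclideanSpace ℝ (Fin n) => (x, y.2.1, (y.2.2 : ℝ))) from rfl, this]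
    rfl
  have hu : (y.1 : EuclideanSpace ℝ (Fin n)) ≠ 0 := ne_zero_of_mem_unit_sphere y.1
  have hs := ext_smooth h
  have hcd : ContDiffAt ℝ ∞ (fun x => ext Φ (x, y.2.1, (y.2.2 : ℝ)))
      (y.1 : EuclideanSpace ℝ (Fin n)) :=
    ContDiffAt.comp (y.1 : EuclideanSpace ℝ (Fin n))
      (g := ext Φ) (f := fun x => (x, y.2.1, (y.2.2 : ℝ)))
      (hs.contDiffAt ((amb n).2.mem_nhds (incl_mem y)))
      (contDiffAt_id.prodMk contDiffAt_const)
  have hdd : DifferentiableAt ℝ (fderiv ℝ (fun x => ext Φ (x, y.2.1, (y.2.2 : ℝ))))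
      (y.1 : EuclideanSpace ℝ (Fin n)) :=
    (hcd.fderiv_right (m := 1) (by norm_cast)).differentiableAt (by simp)
  rw [opU, laplaceBeltrami, hh,
    InnerProductSpace.laplacian_eq_iteratedFDeriv_stdOrthonormalBasis]
  refine Finset.sum_congr rfl fun i _ => ?_
  rw [iteratedFDeriv_two_apply]
  simp only [Matrix.cons_val_zero, Matrix.cons_val_one]
  set v := stdOrthonormalBasis ℝ (EuclideanSpace ℝ (Fin n)) i
  have e1 : fderiv ℝ (fderiv ℝ (fun x => ext Φ (x, y.2.1, (y.2.2 : ℝ))))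
      (y.1 : EuclideanSpace ℝ (Fin n)) v v =
      fderiv ℝ (fun x => fderiv ℝ (fun x => ext Φ (x, y.2.1, (y.2.2 : ℝ))) x v)
        (y.1 : EuclideanSpace ℝ (Fin n)) v := by
    rw [fderiv_clm_apply hdd (differentiableAt_const _)]
    simp
  rw [e1]
  have e2 : (fun x => fderiv ℝ (fun x => ext Φ (x, y.2.1, (y.2.2 : ℝ))) x v) =ᶠ[nhds
      (y.1 : EuclideanSpace ℝ (Fin n))] fun x => dirD (v, 0, 0) (ext Φ) (x, y.2.1, y.2.2) := by
    filter_upwards [isOpen_ne.mem_nhds hu] with x hx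
    exact hG hs x hx v
  rw [e2.fderiv_eq, hG (dirD_smooth _ hs) _ hu]
  rfl

lemma opA_smooth [n.AtLeastTwo] {Φ : Y n → ℂ} (h : IsSmooth Φ) : IsSmooth (opA Φ) := by
  rw [funext (opA_eq h)]
  exact smooth_of_ambient (dirD_smooth _ (ext_smooth h))

lemma opB_smooth [n.AtLeastTwo] {Φ : Y n → ℂ} (h : IsSmooth Φ) : IsSmooth (opB Φ) := by
  rw [funext (opB_eq h)]
  exact smooth_of_ambient (dirD_smooth _ (ext_smooth h))

lemma opU_smooth [n.AtLeastTwo] {Φ : Y n → ℂ} (h : IsSmooth Φ) : IsSmooth (opU Φ) := by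
  rw [funext (opU_eq h)]
  exact smooth_of_ambient (G := fun p => ∑ i,
    dirD (stdOrthonormalBasis ℝ (EuclideanSpace ℝ (Fin n)) i, 0, 0)
      (dirD (stdOrthonormalBasis ℝ (EuclideanSpace ℝ (Fin n)) i, 0, 0) (ext Φ)) p)
    (ContDiffOn.sum fun i _ => dirD_smooth _ (dirD_smooth _ (ext_smooth h)))

lemma smooth_zero [n.AtLeastTwo] : IsSmooth (0 : Y n → ℂ) := contMDiff_const

lemma smooth_add [n.AtLeastTwo] {Φ Ψ : Y n → ℂ} (h : IsSmooth Φ) (h' : IsSmooth Ψ) :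
    IsSmooth (Φ + Ψ) :=
  ContMDiff.add h h'

lemma smooth_smul [n.AtLeastTwo] (c : ℂ) {Φ : Y n → ℂ} (h : IsSmooth Φ) :
    IsSmooth (c • Φ) := by
  have : ContDiff ℝ ∞ (fun z : ℂ => c * z) := contDiff_const.mul contDiff_id
  exact this.contMDiff.comp h

lemma ext_lin (c : ℂ) (Φ Ψ : Y n → ℂ) : ext (c • Φ + Ψ) = fun p => c * ext Φ p + ext Ψ p := by
  funext p; by_cases h : p.1 ≠ 0 ∧ 0 < p.2.2 <;> simp [ext, h]

lemma dirD_congr (v : EuclideanSpace ℝ (Fin n) × ℝ × ℝ)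
    {G H : EuclideanSpace ℝ (Fin n) × ℝ × ℝ → ℂ} (h : Set.EqOn G H (amb n)) :
    Set.EqOn (dirD v G) (dirD v H) (amb n) := by
  intro p hp
  have : G =ᶠ[nhds p] H := Filter.eventuallyEq_of_mem ((amb n).2.mem_nhds hp) h
  rw [dirD, dirD, this.fderiv_eq]

lemma dirD_lin (v : EuclideanSpace ℝ (Fin n) × ℝ × ℝ) (c : ℂ)
    {G H : EuclideanSpace ℝ (Fin n) × ℝ × ℝ → ℂ} (hG : ContDiffOn ℝ ∞ G (amb n))
    (hH : ContDiffOn ℝ ∞ H (amb n)) :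
    Set.EqOn (dirD v fun p => c * G p + H p) (fun p => c * dirD v G p + dirD v H p) (amb n) := by
  intro p hp
  simp only [dirD]
  rw [fderiv_fun_add ((diffAt hG hp).const_mul c) (diffAt hH hp),
    fderiv_const_mul (diffAt hG hp)]
  simp

/-- An operator that preserves smoothness and is linear on smooth functions. -/
structure GoodOp [n.AtLeastTwo] (T : (Y n → ℂ) → Y n → ℂ) : Prop where
  smooth : ∀ {Φ : Y n → ℂ}, IsSmooth Φ → IsSmooth (T Φ)
  lin : ∀ (c : ℂ) {Φ Ψ : Y n → ℂ}, IsSmooth Φ → IsSmooth Ψ → T (c • Φ + Ψ) = c • T Φ + T Ψ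

lemma GoodOp.iterate [n.AtLeastTwo] {T : (Y n → ℂ) → Y n → ℂ} (hT : GoodOp T) (j : ℕ) :
    GoodOp (T^[j]) := by
  induction j with
  | zero => exact ⟨fun h => h, fun c _ _ _ _ => rfl⟩
  | succ j ih =>
    refine ⟨fun h => ?_, fun c Φ Ψ h h' => ?_⟩
    · rw [Function.iterate_succ_apply]; exact ih.smooth (hT.smooth h)
    · simp only [Function.iterate_succ_apply]
      rw [hT.lin c h h', ih.lin c (hT.smooth h) (hT.smooth h')]

lemma opA_good [n.AtLeastTwo] : GoodOp (opA (n := n)) := by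
  refine ⟨opA_smooth, fun c Φ Ψ h h' => ?_⟩
  funext y
  rw [opA_eq (smooth_add (smooth_smul c h) h'), ext_lin,
    dirD_lin _ c (ext_smooth h) (ext_smooth h') (incl_mem y), Pi.add_apply,
    Pi.smul_apply, opA_eq h, opA_eq h', smul_eq_mul]

lemma opB_good [n.AtLeastTwo] : GoodOp (opB (n := n)) := by
  refine ⟨opB_smooth, fun c Φ Ψ h h' => ?_⟩
  funext y
  rw [opB_eq (smooth_add (smooth_smul c h) h'), ext_lin,
    dirD_lin _ c (ext_smooth h) (ext_smooth h') (incl_mem y), Pi.add_apply,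
    Pi.smul_apply, opB_eq h, opB_eq h', smul_eq_mul]

lemma opU_good [n.AtLeastTwo] : GoodOp (opU (n := n)) := by
  refine ⟨opU_smooth, fun c Φ Ψ h h' => ?_⟩
  funext y
  have hs := ext_smooth h
  have hs' := ext_smooth h'
  rw [opU_eq (smooth_add (smooth_smul c h) h'), ext_lin, Pi.add_apply, Pi.smul_apply,
    opU_eq h, opU_eq h', smul_eq_mul, Finset.mul_sum, ← Finset.sum_add_distrib]
  refine Finset.sum_congr rfl fun i _ => ?_
  rw [dirD_congr _ (dirD_lin _ c hs hs') (incl_mem y),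
    dirD_lin _ c (dirD_smooth _ hs) (dirD_smooth _ hs') (incl_mem y)]

lemma diffOp_good [n.AtLeastTwo] (l m k : ℕ) : GoodOp (diffOp (n := n) l m k) := by
  refine ⟨fun h => ?_, fun c Φ Ψ h h' => ?_⟩
  · exact (opA_good.iterate l).smooth ((opB_good.iterate m).smooth ((opU_good.iterate k).smooth h))
  · simp only [diffOp]
    rw [(opU_good.iterate k).lin c h h', (opB_good.iterate m).lin c
      ((opU_good.iterate k).smooth h) ((opU_good.iterate k).smooth h'), (opA_good.iterate l).lin c
      ((opB_good.iterate m).smooth ((opU_good.iterate k).smooth h))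
      ((opB_good.iterate m).smooth ((opU_good.iterate k).smooth h'))]

lemma diffOp_zero [n.AtLeastTwo] (l m k : ℕ) : diffOp l m k (0 : Y n → ℂ) = 0 := by
  simpa using (diffOp_good l m k).lin (-1) (smooth_zero (n := n)) (smooth_zero (n := n))

lemma diffOp_add [n.AtLeastTwo] (l m k : ℕ) {Φ Ψ : Y n → ℂ} (h : IsSmooth Φ) (h' : IsSmooth Ψ) :
    diffOp l m k (Φ + Ψ) = diffOp l m k Φ + diffOp l m k Ψ := by
  simpa using (diffOp_good l m k).lin 1 h h'

lemma diffOp_smul [n.AtLeastTwo] (l m k : ℕ) (c : ℂ) {Φ : Y n → ℂ} (h : IsSmooth Φ) :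
    diffOp l m k (c • Φ) = c • diffOp l m k Φ := by
  simpa [diffOp_zero] using (diffOp_good l m k).lin c h smooth_zero

lemma weight_nonneg (s r : ℕ) (y : Y n) :
    0 ≤ ((y.2.2 : ℝ) ^ s + 1 / (y.2.2 : ℝ) ^ s) * (1 + y.2.1 ^ 2) ^ ((r : ℝ) / 2) := by
  have : (0 : ℝ) < y.2.2 := y.2.2.2
  positivity

lemma weighted_nonneg (s r l m k : ℕ) (Φ : Y n → ℂ) (y : Y n) : 0 ≤ weighted s r l m k Φ y :=
  mul_nonneg (weight_nonneg s r y) (norm_nonneg _)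

lemma weighted_add_le [n.AtLeastTwo] (s r l m k : ℕ) {Φ Ψ : Y n → ℂ} (h : IsSmooth Φ)
    (h' : IsSmooth Ψ) (y : Y n) :
    weighted s r l m k (Φ + Ψ) y ≤ weighted s r l m k Φ y + weighted s r l m k Ψ y := by
  simp only [weighted]
  rw [diffOp_add l m k h h', ← mul_add]
  exact mul_le_mul_of_nonneg_left (norm_add_le _ _) (weight_nonneg s r y)

lemma weighted_smul [n.AtLeastTwo] (s r l m k : ℕ) (c : ℂ) {Φ : Y n → ℂ} (h : IsSmooth Φ)
    (y : Y n) : weighted s r l m k (c • Φ) y = ‖c‖ * weighted s r l m k Φ y := by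
  simp only [weighted]
  rw [diffOp_smul l m k c h, Pi.smul_apply, norm_smul]
  ring

end Smooth

/-! ### The space `S(Y^{n+1})` -/

/-- The vector space underlying `S(Y^{n+1})`: the smooth functions `Φ` on `Y^{n+1}` such that
`sup (a^s + a^{-s}) (1 + b²)^{r/2} |∂_a^l ∂_b^m Δ_u^k Φ (u, b, a)| < ∞` for all `s, r, l, m, k`. -/
def rapidSmooth (n : ℕ) [n.AtLeastTwo] : Submodule ℂ (Y n → ℂ) where
  carrier := {Φ | IsSmooth Φ ∧
    ∀ s r l m k : ℕ, BddAbove (Set.range fun y : Y n => weighted s r l m k Φ y)}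
  zero_mem' := by
    refine ⟨smooth_zero, fun s r l m k => ⟨0, ?_⟩⟩
    rintro _ ⟨y, rfl⟩
    simp [weighted, diffOp_zero]
  add_mem' := by
    rintro Φ Ψ ⟨h, hb⟩ ⟨h', hb'⟩
    refine ⟨smooth_add h h', fun s r l m k => ?_⟩
    obtain ⟨C, hC⟩ := hb s r l m k
    obtain ⟨C', hC'⟩ := hb' s r l m k
    refine ⟨C + C', ?_⟩
    rintro _ ⟨y, rfl⟩
    exact (weighted_add_le s r l m k h h' y).trans
      (add_le_add (hC ⟨y, rfl⟩) (hC' ⟨y, rfl⟩))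
  smul_mem' := by
    rintro c Φ ⟨h, hb⟩
    refine ⟨smooth_smul c h, fun s r l m k => ?_⟩
    obtain ⟨C, hC⟩ := hb s r l m k
    refine ⟨‖c‖ * C, ?_⟩
    rintro _ ⟨y, rfl⟩
    simp only [weighted_smul s r l m k c h y]
    exact mul_le_mul_of_nonneg_left (hC ⟨y, rfl⟩) (norm_nonneg c)

/-- The space `S(Y^{n+1})`. It is kept apart from the submodule `rapidSmooth n`, so that it does
not inherit the topology of pointwise convergence from `Y^{n+1} → ℂ`. -/
def SY (n : ℕ) [n.AtLeastTwo] : Type := rapidSmooth n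

instance (n : ℕ) [n.AtLeastTwo] : AddCommGroup (SY n) := 
  inferInstanceAs (AddCommGroup (rapidSmooth n))

instance (n : ℕ) [n.AtLeastTwo] : Module ℂ (SY n) := inferInstanceAs (Module ℂ (rapidSmooth n))

instance (n : ℕ) [n.AtLeastTwo] : CoeFun (SY n) (fun _ => Y n → ℂ) := ⟨fun Φ => Φ.1⟩

/-- The seminorm `ρ_{s,r}^{l,m,k}` on `S(Y^{n+1})`. -/
def rho (n : ℕ) [n.AtLeastTwo] (s r l m k : ℕ) : Seminorm ℂ (SY n) :=
  Seminorm.of (fun Φ => ⨆ y : Y n, weighted s r l m k Φ.1 y)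
    (by
      intro Φ Ψ
      refine Real.iSup_le (fun y => ?_) (add_nonneg
        (Real.iSup_nonneg fun y => weighted_nonneg s r l m k Φ.1 y)
        (Real.iSup_nonneg fun y => weighted_nonneg s r l m k Ψ.1 y))
      exact (weighted_add_le s r l m k Φ.2.1 Ψ.2.1 y).trans
        (add_le_add (le_ciSup (Φ.2.2 s r l m k) y) (le_ciSup (Ψ.2.2 s r l m k) y)))
    (by
      intro c Φ
      rw [Real.mul_iSup_of_nonneg (norm_nonneg c)]
      exact iSup_congr fun y => weighted_smul s r l m k c Φ.2.1 y)

/-- The defining family of seminorms of `S(Y^{n+1})`, indexed by `(s, r, l, m, k)`. -/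
def rhoFamily (n : ℕ) [n.AtLeastTwo] : SeminormFamily ℂ (SY n) (ℕ × ℕ × ℕ × ℕ × ℕ) :=
  fun i => rho n i.1 i.2.1 i.2.2.1 i.2.2.2.1 i.2.2.2.2

/-- The locally convex topology of `S(Y^{n+1})` defined by the seminorms `ρ_{s,r}^{l,m,k}`. -/
instance topologySY (n : ℕ) [n.AtLeastTwo] : TopologicalSpace (SY n) :=
  (rhoFamily n).moduleFilterBasis.topology

lemma withSeminorms_SY (n : ℕ) [n.AtLeastTwo] : WithSeminorms (rhoFamily n) := ⟨rfl⟩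

/-! ### The ridgelet transform -/

/-- The ridgelet `ψ_{u,b,a}(x) = (1/a) ψ((x · u - b) / a)`. -/
def ridgelet {n : ℕ} (ψ : ℝ → ℂ) (y : Y n) (x : EuclideanSpace ℝ (Fin n)) : ℂ :=
  (1 / ((y.2.2 : ℝ) : ℂ)) *
    ψ ((inner ℝ x (y.1 : EuclideanSpace ℝ (Fin n)) - y.2.1) / (y.2.2 : ℝ))

/-- The ridgelet transform `R_ψ f (u, b, a) = ∫ f(x) conj (ψ_{u,b,a}(x)) dx`. -/
def ridgeletTransform {n : ℕ} (ψ : ℝ → ℂ) (f : EuclideanSpace ℝ (Fin n) → ℂ) (y : Y n) : ℂ :=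
  ∫ x, f x * starRingEnd ℂ (ridgelet ψ y x)

end Ridgelet

end

/-!
The ridgelet transform at `(u, b, a)` is `1/a` times the plane wave integral
`W(f, ψ)(v, c) = ∫ f(x) conj (ψ(x · v - c)) dx` at `v = u / a`, `c = b / a`.

*Decay.* Always `|W(f, ψ)| ≤ ‖f‖₁ sup |ψ|`. If all moments of `f` vanish, then `W` vanishes at
`v = 0`, and the derivative of `W(f, ψ)` in `v_i` is `W(x_i f, ψ')`, which is again of this type;
so the mean value theorem gives `|W(f, ψ)| = O(|v|^N)` for every `N`
(`dominated_waveInt_le_pow`). If all moments of `ψ` vanish, then `ψ` has an antiderivative `Ψ` in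
`S₀(ℝ)` that depends continuously on `ψ` (`lizPrimitive`), and integration by parts in the
direction `v` gives `|v|² W(f, ψ) = -∑ v_i W(∂_i f, Ψ)`, hence `|W(f, ψ)| = O(|v|^{-N})`
(`dominated_pow_norm_mul_waveInt`). As `|v| = 1 / a`, these are the decay for large and for
small `a`. Decay in `b` follows from `c W(f, ψ) = ∑ v_i W(x_i f, ψ) - W(f, t ψ)`
(`snd_mul_waveInt`). All bounds are products of a continuous seminorm of `f` and one of `ψ`.

*Derivatives.* On the ambient space of triples `(w, b, a)`, `w ≠ 0`, `a > 0`, the functions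
`W(A f, B ψ)(w / (|w| a), b / a)`, with `A` and `B` composed of multiplications by the variables
and derivatives, multiplied by polynomials in `w_i`, `1 / |w|`, `b`, `1 / a`, span a class that is
closed under directional derivatives and under the substitution `w ↦ w / |w|`
(`IsWave.exists_dirD`, `IsWave.exists_normalizeFst`). Since `∂_a`, `∂_b` and the Laplace–Beltrami
operator are directional derivatives of the extension that is constant on rays, they preserve the
restrictions of this class to `Y^{n+1}` (`preservesWaves_diffOp`), and no explicit formula for the
iterated operators is needed. Multiplication by the coefficients preserves rapid decay
(`IsWave.rapidlyDominated`), because on the sphere `|w_i| ≤ 1 = |w|`.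
-/

noncomputable section

namespace Ridgelet

open MeasureTheory SchwartzMap

/-! ### Operators on the Lizorkin spaces -/

lemma hasTemperateGrowth_coord {n : ℕ} (i : Fin n) :
    (fun x : EuclideanSpace ℝ (Fin n) => (x i : ℂ)).HasTemperateGrowth :=
  (Complex.ofRealCLM.comp (EuclideanSpace.proj i :
    EuclideanSpace ℝ (Fin n) →L[ℝ] ℝ)).hasTemperateGrowth

/-- Multiplication of Schwartz functions on `ℝⁿ` by the coordinate `x_i`. -/
def coordMul {n : ℕ} (i : Fin n) :
    𝓢(EuclideanSpace ℝ (Fin n), ℂ) →L[ℂ] 𝓢(EuclideanSpace ℝ (Fin n), ℂ) :=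
  smulLeftCLM ℂ fun x : EuclideanSpace ℝ (Fin n) => (x i : ℂ)

lemma coordMul_apply {n : ℕ} (i : Fin n) (f : 𝓢(EuclideanSpace ℝ (Fin n), ℂ))
    (x : EuclideanSpace ℝ (Fin n)) : coordMul i f x = x i * f x := by
  simp [coordMul, smulLeftCLM_apply_apply (hasTemperateGrowth_coord i)]

/-- Multiplication of Schwartz functions on the line by the variable. -/
def lineMul : 𝓢(ℝ, ℂ) →L[ℂ] 𝓢(ℝ, ℂ) := smulLeftCLM ℂ fun t : ℝ => (t : ℂ)

lemma lineMul_apply (ψ : 𝓢(ℝ, ℂ)) (t : ℝ) : lineMul ψ t = t * ψ t := by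
  have h : (fun t : ℝ => (t : ℂ)).HasTemperateGrowth := Complex.ofRealCLM.hasTemperateGrowth
  simp [lineMul, smulLeftCLM_apply_apply h]

lemma coordMul_mem {n : ℕ} (i : Fin n) {f : 𝓢(EuclideanSpace ℝ (Fin n), ℂ)}
    (hf : f ∈ lizorkin n) : coordMul i f ∈ lizorkin n := by
  intro m
  rw [← hf (m + Pi.single i 1)]
  congr 1
  funext x
  have h : ∏ j, (x j : ℂ) ^ (Pi.single i 1 : Fin n → ℕ) j = x i := by
    rw [Finset.prod_eq_single i] <;> simp +contextual
  simp only [coordMul_apply, Pi.add_apply, pow_add, Finset.prod_mul_distrib, h]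
  ring

lemma lineMul_mem {ψ : 𝓢(ℝ, ℂ)} (hψ : ψ ∈ lizorkinLine) : lineMul ψ ∈ lizorkinLine := by
  intro m
  rw [← hψ (m + 1)]
  congr 1
  funext t
  rw [lineMul_apply]
  ring

lemma integrable_pow_mul_schwartz (m : ℕ) (ψ : 𝓢(ℝ, ℂ)) :
    Integrable fun t : ℝ => (t : ℂ) ^ m * ψ t := by
  have h : (fun t : ℝ => (t : ℂ) ^ m).HasTemperateGrowth :=
    Complex.ofRealCLM.hasTemperateGrowth.pow m
  have := (smulLeftCLM ℂ (fun t : ℝ => (t : ℂ) ^ m) ψ).integrable (μ := volume)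
  rw [smulLeftCLM_apply h] at this
  simpa using this

lemma integral_pow_succ_mul_deriv (m : ℕ) (ψ : 𝓢(ℝ, ℂ)) :
    ∫ t : ℝ, (t : ℂ) ^ (m + 1) * derivCLM ℂ ℂ ψ t = -((m + 1) * ∫ t : ℝ, (t : ℂ) ^ m * ψ t) := by
  have hd : ∀ t : ℝ, HasDerivAt (fun t : ℝ => (t : ℂ) ^ (m + 1) * ψ t)
      ((m + 1) * ((t : ℂ) ^ m * ψ t) + (t : ℂ) ^ (m + 1) * derivCLM ℂ ℂ ψ t) t := by
    intro t
    have := ((hasDerivAt_id t).ofReal_comp.pow (m + 1)).mul (ψ.hasDerivAt t)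
    refine (this.congr_deriv ?_ :)
    simp [derivCLM_apply]
    ring
  have h := integral_eq_zero_of_hasDerivAt_of_integrable hd
    (((integrable_pow_mul_schwartz m ψ).const_mul _).add (integrable_pow_mul_schwartz _ _))
    (integrable_pow_mul_schwartz _ _)
  rw [integral_add ((integrable_pow_mul_schwartz m ψ).const_mul _)
    (integrable_pow_mul_schwartz _ _), integral_const_mul] at h
  exact eq_neg_of_add_eq_zero_right h

lemma derivCLM_mem {ψ : 𝓢(ℝ, ℂ)} (hψ : ψ ∈ lizorkinLine) : derivCLM ℂ ℂ ψ ∈ lizorkinLine := by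
  intro m
  cases m with
  | zero =>
    simpa [derivCLM_apply] using integral_eq_zero_of_hasDerivAt_of_integrable ψ.hasDerivAt
      (derivCLM ℂ ℂ ψ).integrable ψ.integrable
  | succ m => rw [integral_pow_succ_mul_deriv, hψ m, mul_zero, neg_zero]

/-- Multiplication by `x_i` as an operator on `S₀(ℝⁿ)`. -/
def lizCoordMul {n : ℕ} (i : Fin n) : lizorkin n →L[ℂ] lizorkin n :=
  (coordMul i).restrict fun _ h => coordMul_mem i h

/-- Multiplication by the variable as an operator on `S₀(ℝ)`. -/
def lizLineMul : lizorkinLine →L[ℂ] lizorkinLine := lineMul.restrict fun _ h => lineMul_mem h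

/-- Differentiation as an operator on `S₀(ℝ)`. -/
def lizDeriv : lizorkinLine →L[ℂ] lizorkinLine :=
  (derivCLM ℂ ℂ).restrict fun _ h => derivCLM_mem h

/-! ### The antiderivative on the Lizorkin space of the line -/

lemma hasDerivAt_integral_Iic (ψ : 𝓢(ℝ, ℂ)) (t : ℝ) :
    HasDerivAt (fun t => ∫ s in Set.Iic t, ψ s) (ψ t) t := by
  have h : (fun t => ∫ s in Set.Iic t, ψ s) =
      fun t => (∫ s in Set.Iic 0, ψ s) + ∫ s in (0 : ℝ)..t, ψ s := by
    funext t
    rw [intervalIntegral.integral_Iic_sub_Iic ψ.integrable.integrableOn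
      ψ.integrable.integrableOn |>.symm]
    ring
  rw [h]
  exact (intervalIntegral.integral_hasDerivAt_right (ψ.continuous.intervalIntegrable _ _)
    (ψ.continuous.stronglyMeasurableAtFilter _ _) ψ.continuous.continuousAt).const_add _

/-- The antiderivative that vanishes at `-∞` inherits the decay of a Schwartz function of integral
zero: on each half-line it is the integral over the tail on which `|t| ≤ |s|`. -/
lemma pow_mul_norm_integral_Iic_le {ψ : 𝓢(ℝ, ℂ)} (h0 : ∫ s, ψ s = 0) (k : ℕ) (t : ℝ) :
    |t| ^ k * ‖∫ s in Set.Iic t, ψ s‖ ≤ ∫ s, |s| ^ k * ‖ψ s‖ := by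
  have hi : Integrable fun s => |s| ^ k * ‖ψ s‖ := by
    simpa using ψ.integrable_pow_mul volume k
  have key : ∀ S : Set ℝ, MeasurableSet S → (∀ s ∈ S, |t| ≤ |s|) →
      |t| ^ k * ‖∫ s in S, ψ s‖ ≤ ∫ s, |s| ^ k * ‖ψ s‖ := by
    intro S hS hle
    calc |t| ^ k * ‖∫ s in S, ψ s‖ ≤ |t| ^ k * ∫ s in S, ‖ψ s‖ := by
          gcongr; exact norm_integral_le_integral_norm _
      _ = ∫ s in S, |t| ^ k * ‖ψ s‖ := (integral_const_mul _ _).symm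
      _ ≤ ∫ s in S, |s| ^ k * ‖ψ s‖ := by
          refine setIntegral_mono_on (ψ.integrable.norm.const_mul _).integrableOn
            hi.integrableOn hS fun s hs => ?_
          exact mul_le_mul_of_nonneg_right (pow_le_pow_left₀ (abs_nonneg t) (hle s hs) k)
            (norm_nonneg _)
      _ ≤ ∫ s, |s| ^ k * ‖ψ s‖ :=
          setIntegral_le_integral hi (Filter.Eventually.of_forall fun s => by positivity)
  rcases le_total t 0 with ht | ht
  · refine key _ measurableSet_Iic fun s hs => ?_
    rw [abs_of_nonpos ht, abs_of_nonpos (le_trans hs ht)]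
    exact neg_le_neg hs
  · have : ∫ s in Set.Iic t, ψ s = -∫ s in Set.Ioi t, ψ s := by
      have := intervalIntegral.integral_Iic_add_Ioi (f := ψ) (b := t) (μ := volume)
        ψ.integrable.integrableOn ψ.integrable.integrableOn
      rw [h0] at this
      exact eq_neg_of_add_eq_zero_left this
    rw [this, norm_neg]
    refine key _ measurableSet_Ioi fun s hs => ?_
    have hs' : t < s := hs
    rw [abs_of_nonneg ht, abs_of_nonneg (ht.trans hs'.le)]
    exact hs'.le

lemma integral_lizorkinLine (ψ : lizorkinLine) : ∫ s, ψ.1 s = 0 := by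
  simpa using ψ.2 0

lemma contDiff_integral_Iic (ψ : 𝓢(ℝ, ℂ)) : ContDiff ℝ ∞ fun t => ∫ s in Set.Iic t, ψ s := by
  rw [contDiff_infty_iff_deriv]
  refine ⟨fun t => (hasDerivAt_integral_Iic ψ t).differentiableAt, ?_⟩
  rw [funext fun t => (hasDerivAt_integral_Iic ψ t).deriv]
  exact ψ.smooth'

lemma iteratedDeriv_integral_Iic (ψ : 𝓢(ℝ, ℂ)) (j : ℕ) :
    iteratedDeriv (j + 1) (fun t => ∫ s in Set.Iic t, ψ s) = iteratedDeriv j ψ := by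
  rw [iteratedDeriv_succ', funext fun t => (hasDerivAt_integral_Iic ψ t).deriv]

/-- The Schwartz function `t ↦ ∫_{-∞}^t ψ`, for `ψ ∈ S₀(ℝ)`. -/
def primitive (ψ : lizorkinLine) : 𝓢(ℝ, ℂ) where
  toFun t := ∫ s in Set.Iic t, ψ.1 s
  smooth' := contDiff_integral_Iic ψ.1
  decay' k j := by
    cases j with
    | zero =>
      refine ⟨∫ s, |s| ^ k * ‖ψ.1 s‖, fun t => ?_⟩
      rw [norm_iteratedFDeriv_zero]
      exact pow_mul_norm_integral_Iic_le (integral_lizorkinLine ψ) k t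
    | succ j =>
      obtain ⟨C, hC⟩ := ψ.1.decay' k j
      refine ⟨C, fun t => ?_⟩
      have := hC t
      rw [norm_iteratedFDeriv_eq_norm_iteratedDeriv] at this ⊢
      rwa [iteratedDeriv_integral_Iic]

lemma primitive_apply (ψ : lizorkinLine) (t : ℝ) :
    primitive ψ t = ∫ s in Set.Iic t, ψ.1 s := rfl

lemma derivCLM_primitive (ψ : lizorkinLine) : derivCLM ℂ ℂ (primitive ψ) = ψ.1 := by
  refine SchwartzMap.ext fun t => ?_
  rw [derivCLM_apply]
  exact (hasDerivAt_integral_Iic ψ.1 t).deriv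

lemma primitive_mem (ψ : lizorkinLine) : primitive ψ ∈ lizorkinLine := by
  intro m
  have h := integral_pow_succ_mul_deriv m (primitive ψ)
  rw [derivCLM_primitive, ψ.2 (m + 1), zero_eq_neg, mul_eq_zero] at h
  exact h.resolve_left (by exact_mod_cast m.succ_ne_zero)

/-- `ψ ↦ ∫_{-∞}^t ψ` as a linear map. -/
def primitiveLM : lizorkinLine →ₗ[ℂ] 𝓢(ℝ, ℂ) where
  toFun := primitive
  map_add' ψ χ := by
    refine SchwartzMap.ext fun t => ?_
    simp [primitive_apply, integral_add ψ.1.integrable.integrableOn χ.1.integrable.integrableOn]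
  map_smul' c ψ := by
    refine SchwartzMap.ext fun t => ?_
    simp [primitive_apply, integral_const_mul]

lemma continuous_seminorm_lizorkinLine (k j : ℕ) :
    Continuous ((SchwartzMap.seminorm ℂ k j).comp lizorkinLine.subtype) :=
  ((schwartz_withSeminorms ℂ ℝ ℂ).continuous_seminorm (k, j)).comp continuous_subtype_val

lemma continuous_primitiveLM : Continuous primitiveLM := by
  refine (schwartz_withSeminorms ℂ ℝ ℂ).continuous_of_continuous_comp primitiveLM ?_
  rintro ⟨k, j⟩
  cases j with
  | zero =>
    -- `N` and `C` are the exponent and the constant of the bound of `∫ |s|^k |ψ(s)| ds` by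
    -- Schwartz seminorms.
    set N := (volume : Measure ℝ).integrablePower
    set C : NNReal := ⟨2 ^ N * ∫ x : ℝ, (1 + ‖x‖) ^ (-(N : ℝ)), by positivity⟩ with hC
    refine Seminorm.continuous_of_le (q := C • ((SchwartzMap.seminorm ℂ 0 0).comp
      lizorkinLine.subtype + (SchwartzMap.seminorm ℂ (k + N) 0).comp lizorkinLine.subtype)) ?_ ?_
    · exact ((continuous_seminorm_lizorkinLine 0 0).add
        (continuous_seminorm_lizorkinLine (k + N) 0)).const_smul C
    · intro ψ
      refine SchwartzMap.seminorm_le_bound ℂ k 0 _ (apply_nonneg _ _) fun t => ?_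
      rw [norm_iteratedFDeriv_zero]
      refine (pow_mul_norm_integral_Iic_le (integral_lizorkinLine ψ) k t).trans ?_
      have := integral_pow_mul_iteratedFDeriv_le ℂ volume ψ.1 k 0
      simp only [norm_iteratedFDeriv_zero, Real.norm_eq_abs] at this
      exact this
  | succ j =>
    refine Seminorm.continuous_of_le (continuous_seminorm_lizorkinLine k j) fun ψ => ?_
    refine SchwartzMap.seminorm_le_bound ℂ k (j + 1) _ (apply_nonneg _ _) fun t => ?_
    have := SchwartzMap.le_seminorm ℂ k j ψ.1 t
    rw [norm_iteratedFDeriv_eq_norm_iteratedDeriv] at this ⊢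
    change _ * ‖iteratedDeriv (j + 1) (fun t => ∫ s in Set.Iic t, ψ.1 s) t‖ ≤ _
    rw [iteratedDeriv_integral_Iic]
    exact this

/-- The antiderivative as an operator on `S₀(ℝ)`. -/
def lizPrimitive : lizorkinLine →L[ℂ] lizorkinLine :=
  (⟨primitiveLM, continuous_primitiveLM⟩ : lizorkinLine →L[ℂ] 𝓢(ℝ, ℂ)).codRestrict lizorkinLine
    primitive_mem

lemma derivCLM_lizPrimitive (ψ : lizorkinLine) : derivCLM ℂ ℂ (lizPrimitive ψ).1 = ψ.1 :=
  derivCLM_primitive ψ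

/-! ### Bilinear domination by continuous seminorms -/

section Dominated

variable {E F ι : Type*} [AddCommGroup E] [Module ℂ E] [TopologicalSpace E]
  [AddCommGroup F] [Module ℂ F] [TopologicalSpace F]

/-- `N` is dominated, uniformly in the parameter `y`, by the product of a continuous seminorm of
the first and a continuous seminorm of the second variable. -/
def Dominated (N : E → F → ι → ℝ) : Prop :=
  ∃ (p : Seminorm ℂ E) (q : Seminorm ℂ F), Continuous p ∧ Continuous q ∧
    ∀ f ψ y, N f ψ y ≤ p f * q ψ

namespace Dominated

variable {N M : E → F → ι → ℝ}

lemma mono (h : Dominated M) (hle : ∀ f ψ y, N f ψ y ≤ M f ψ y) : Dominated N := by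
  obtain ⟨p, q, hp, hq, h⟩ := h
  exact ⟨p, q, hp, hq, fun f ψ y => (hle f ψ y).trans (h f ψ y)⟩

lemma zero : Dominated (fun (_ : E) (_ : F) (_ : ι) => 0) :=
  ⟨0, 0, continuous_const, continuous_const, fun _ _ _ => by simp⟩

lemma add (hN : Dominated N) (hM : Dominated M) :
    Dominated fun f ψ y => N f ψ y + M f ψ y := by
  obtain ⟨p, q, hp, hq, h⟩ := hN
  obtain ⟨p', q', hp', hq', h'⟩ := hM
  refine ⟨p + p', q + q', hp.add hp', hq.add hq', fun f ψ y => ?_⟩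
  have h1 := h f ψ y
  have h2 := h' f ψ y
  have h3 : 0 ≤ p f * q' ψ := mul_nonneg (apply_nonneg _ _) (apply_nonneg _ _)
  have h4 : 0 ≤ p' f * q ψ := mul_nonneg (apply_nonneg _ _) (apply_nonneg _ _)
  simp only [_root_.add_apply]
  linarith

lemma sum {κ : Type*} (s : Finset κ) {N : κ → E → F → ι → ℝ} (h : ∀ i, Dominated (N i)) :
    Dominated fun f ψ y => ∑ i ∈ s, N i f ψ y := by
  classical
  induction s using Finset.induction_on with
  | empty => simpa using zero
  | insert i s hi ih => simpa [Finset.sum_insert hi] using (h i).add ih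

lemma const_mul (C : NNReal) (hN : Dominated N) : Dominated fun f ψ y => C * N f ψ y := by
  obtain ⟨p, q, hp, hq, h⟩ := hN
  refine ⟨C • p, q, hp.const_smul C, hq, fun f ψ y => ?_⟩
  have : (C • p) f = C * p f := rfl
  rw [this, mul_assoc]
  exact mul_le_mul_of_nonneg_left (h f ψ y) C.2

lemma comp {E' F' : Type*} [AddCommGroup E'] [Module ℂ E'] [TopologicalSpace E']
    [AddCommGroup F'] [Module ℂ F'] [TopologicalSpace F'] (hN : Dominated N)
    (A : E' →L[ℂ] E) (B : F' →L[ℂ] F) : Dominated fun f ψ y => N (A f) (B ψ) y := by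
  obtain ⟨p, q, hp, hq, h⟩ := hN
  exact ⟨p.comp A.toLinearMap, q.comp B.toLinearMap, hp.comp A.continuous, hq.comp B.continuous,
    fun f ψ y => h _ _ y⟩

end Dominated

end Dominated

/-! ### The plane wave integral -/

variable {n : ℕ}

/-- The integral `∫ f(x) conj (ψ(x · v - c)) dx` at `z = (v, c) ∈ ℝⁿ × ℝ`. The ridgelet transform
at `(u, b, a)` is `1/a` times its value at `(u/a, b/a)`. -/
def waveInt (f : 𝓢(EuclideanSpace ℝ (Fin n), ℂ)) (ψ : 𝓢(ℝ, ℂ))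
    (z : EuclideanSpace ℝ (Fin n) × ℝ) : ℂ :=
  ∫ x, f x * starRingEnd ℂ (ψ (inner ℝ x z.1 - z.2))

lemma integrable_mul_wave (f : 𝓢(EuclideanSpace ℝ (Fin n), ℂ)) (ψ : 𝓢(ℝ, ℂ))
    (z : EuclideanSpace ℝ (Fin n) × ℝ) :
    Integrable fun x => f x * starRingEnd ℂ (ψ (inner ℝ x z.1 - z.2)) := by
  refine f.integrable.mul_bdd (c := SchwartzMap.seminorm ℂ 0 0 ψ) ?_ ?_
  · have := ψ.continuous
    exact Continuous.aestronglyMeasurable (by fun_prop)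
  · refine Filter.Eventually.of_forall fun x => ?_
    rw [RCLike.norm_conj]
    exact SchwartzMap.norm_le_seminorm ℂ ψ _

lemma waveInt_add_left (f g : 𝓢(EuclideanSpace ℝ (Fin n), ℂ)) (ψ : 𝓢(ℝ, ℂ)) (z) :
    waveInt (f + g) ψ z = waveInt f ψ z + waveInt g ψ z := by
  simp only [waveInt, _root_.add_apply, add_mul]
  exact integral_add (integrable_mul_wave f ψ z) (integrable_mul_wave g ψ z)

lemma waveInt_smul_left (c : ℂ) (f : 𝓢(EuclideanSpace ℝ (Fin n), ℂ)) (ψ : 𝓢(ℝ, ℂ)) (z) :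
    waveInt (c • f) ψ z = c * waveInt f ψ z := by
  simp only [waveInt, _root_.smul_apply, smul_eq_mul, mul_assoc]
  exact integral_const_mul _ _

lemma waveInt_add_right (f : 𝓢(EuclideanSpace ℝ (Fin n), ℂ)) (ψ χ : 𝓢(ℝ, ℂ)) (z) :
    waveInt f (ψ + χ) z = waveInt f ψ z + waveInt f χ z := by
  simp only [waveInt, _root_.add_apply, map_add, mul_add]
  exact integral_add (integrable_mul_wave f ψ z) (integrable_mul_wave f χ z)

lemma waveInt_smul_right (c : ℂ) (f : 𝓢(EuclideanSpace ℝ (Fin n), ℂ)) (ψ : 𝓢(ℝ, ℂ)) (z) :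
    waveInt f (c • ψ) z = starRingEnd ℂ c * waveInt f ψ z := by
  simp only [waveInt, _root_.smul_apply, smul_eq_mul, map_mul, mul_left_comm]
  exact integral_const_mul _ _

lemma waveInt_sum_left {κ : Type*} (s : Finset κ) (f : κ → 𝓢(EuclideanSpace ℝ (Fin n), ℂ))
    (ψ : 𝓢(ℝ, ℂ)) (z) : waveInt (∑ i ∈ s, f i) ψ z = ∑ i ∈ s, waveInt (f i) ψ z :=
  map_sum (⟨⟨fun f => waveInt f ψ z, by simp [waveInt]⟩, fun f g => waveInt_add_left f g ψ z⟩ :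
    𝓢(EuclideanSpace ℝ (Fin n), ℂ) →+ ℂ) f s

lemma dominated_waveInt : Dominated fun (f : 𝓢(EuclideanSpace ℝ (Fin n), ℂ)) (ψ : 𝓢(ℝ, ℂ)) z =>
    ‖waveInt f ψ z‖ := by
  refine ⟨(normSeminorm ℂ _).comp (toLpCLM ℂ ℂ 1 volume).toLinearMap, SchwartzMap.seminorm ℂ 0 0,
    continuous_norm.comp (toLpCLM ℂ ℂ 1 volume).continuous,
    (schwartz_withSeminorms ℂ ℝ ℂ).continuous_seminorm (0, 0), fun f ψ z => ?_⟩
  have : ((normSeminorm ℂ _).comp (toLpCLM ℂ ℂ 1 volume).toLinearMap) f = ∫ x, ‖f x‖ :=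
    norm_toLp_one
  rw [this, ← integral_mul_const]
  refine norm_integral_le_of_norm_le (f.integrable.norm.mul_const _)
    (Filter.Eventually.of_forall fun x => ?_)
  rw [norm_mul, RCLike.norm_conj]
  exact mul_le_mul_of_nonneg_left (SchwartzMap.norm_le_seminorm ℂ ψ _) (norm_nonneg _)

/-- The derivative of `waveInt f ψ` at `z`. -/
def waveIntDeriv (f : 𝓢(EuclideanSpace ℝ (Fin n), ℂ)) (ψ : 𝓢(ℝ, ℂ))
    (z : EuclideanSpace ℝ (Fin n) × ℝ) : EuclideanSpace ℝ (Fin n) × ℝ →L[ℝ] ℂ :=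
  (∑ i, ((EuclideanSpace.proj i : EuclideanSpace ℝ (Fin n) →L[ℝ] ℝ).comp
      (ContinuousLinearMap.fst ℝ _ _)).smulRight (waveInt (coordMul i f) (derivCLM ℂ ℂ ψ) z)) -
    (ContinuousLinearMap.snd ℝ _ _).smulRight (waveInt f (derivCLM ℂ ℂ ψ) z)

lemma waveIntDeriv_apply (f : 𝓢(EuclideanSpace ℝ (Fin n), ℂ)) (ψ : 𝓢(ℝ, ℂ))
    (z h : EuclideanSpace ℝ (Fin n) × ℝ) : waveIntDeriv f ψ z h =
      (∑ i, (h.1 i : ℂ) * waveInt (coordMul i f) (derivCLM ℂ ℂ ψ) z) -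
        (h.2 : ℂ) * waveInt f (derivCLM ℂ ℂ ψ) z := by
  simp [waveIntDeriv]

lemma inner_eq_sum_mul (x v : EuclideanSpace ℝ (Fin n)) : inner ℝ x v = ∑ i, v i * x i := by
  simp [PiLp.inner_apply]

lemma hasFDerivAt_waveInt (f : 𝓢(EuclideanSpace ℝ (Fin n), ℂ)) (ψ : 𝓢(ℝ, ℂ))
    (z : EuclideanSpace ℝ (Fin n) × ℝ) :
    HasFDerivAt (waveInt f ψ) (waveIntDeriv f ψ z) z := by
  set ℓ : EuclideanSpace ℝ (Fin n) → EuclideanSpace ℝ (Fin n) × ℝ →L[ℝ] ℝ := fun x =>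
    (innerSL ℝ x).comp (ContinuousLinearMap.fst ℝ _ _) - ContinuousLinearMap.snd ℝ _ _ with hℓ
  have hℓc : Continuous ℓ := by
    rw [hℓ]
    exact ((innerSL ℝ).continuous.clm_comp continuous_const).sub continuous_const
  set F' : EuclideanSpace ℝ (Fin n) × ℝ → EuclideanSpace ℝ (Fin n) →
      EuclideanSpace ℝ (Fin n) × ℝ →L[ℝ] ℂ := fun z x =>
    (ℓ x).smulRight (f x * starRingEnd ℂ (derivCLM ℂ ℂ ψ (inner ℝ x z.1 - z.2))) with hF'
  set S := SchwartzMap.seminorm ℂ 0 0 (derivCLM ℂ ℂ ψ)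
  have hℓn : ∀ x, ‖ℓ x‖ ≤ ‖x‖ + 1 := by
    intro x
    refine (norm_sub_le _ _).trans (add_le_add ?_ (ContinuousLinearMap.norm_snd_le _ _ _))
    refine (ContinuousLinearMap.opNorm_comp_le _ _).trans ?_
    rw [innerSL_apply_norm]
    exact mul_le_of_le_one_right (norm_nonneg _) (ContinuousLinearMap.norm_fst_le _ _ _)
  have hF'c : ∀ z, Continuous (F' z) := by
    intro z
    have h1 := f.continuous
    have h2 := (derivCLM ℂ ℂ ψ).continuous
    have h3 : Continuous fun x => f x * starRingEnd ℂ (derivCLM ℂ ℂ ψ (inner ℝ x z.1 - z.2)) := by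
      fun_prop
    exact (ContinuousLinearMap.smulRightL ℝ _ ℂ).continuous₂.comp (hℓc.prodMk h3)
  have hF'b : ∀ z x, ‖F' z x‖ ≤ (‖x‖ + 1) * (‖f x‖ * S) := by
    intro z x
    rw [hF', ContinuousLinearMap.norm_smulRight_apply, norm_mul, RCLike.norm_conj]
    gcongr
    · exact hℓn x
    · exact SchwartzMap.norm_le_seminorm ℂ _ _
  have hbi : Integrable fun x => (‖x‖ + 1) * (‖f x‖ * S) := by
    have := ((f.integrable_pow_mul volume 1).add f.integrable.norm).mul_const S
    refine this.congr (Filter.Eventually.of_forall fun x => ?_)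
    simp
    ring
  have key := hasFDerivAt_integral_of_dominated_of_fderiv_le (μ := volume) (𝕜 := ℝ)
    (F := fun z x => f x * starRingEnd ℂ (ψ (inner ℝ x z.1 - z.2))) (F' := F') (x₀ := z)
    (bound := fun x => (‖x‖ + 1) * (‖f x‖ * S)) (s := Set.univ) Filter.univ_mem
    (Filter.Eventually.of_forall fun z => (integrable_mul_wave f ψ z).aestronglyMeasurable)
    (integrable_mul_wave f ψ z) (hF'c z).aestronglyMeasurable
    (Filter.Eventually.of_forall fun x z _ => hF'b z x) hbi
    (Filter.Eventually.of_forall fun x z _ => ?_)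
  · refine key.congr_fderiv ?_
    have hi : Integrable (F' z) :=
      hbi.mono' (hF'c z).aestronglyMeasurable (Filter.Eventually.of_forall (hF'b z))
    refine ContinuousLinearMap.ext fun h => ?_
    rw [ContinuousLinearMap.integral_apply hi, waveIntDeriv_apply]
    simp only [waveInt]
    simp_rw [← integral_const_mul]
    rw [← integral_finsetSum _ fun i _ => (integrable_mul_wave _ _ z).const_mul _,
      ← integral_sub (integrable_finsetSum _ fun i _ => (integrable_mul_wave _ _ z).const_mul _)
        ((integrable_mul_wave _ _ z).const_mul _)]
    congr 1
    funext x
    simp only [hF', hℓ, coordMul_apply, ContinuousLinearMap.smulRight_apply,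
      _root_.sub_apply, ContinuousLinearMap.comp_apply, innerSL_apply_apply,
      ContinuousLinearMap.coe_fst', ContinuousLinearMap.coe_snd', Complex.real_smul]
    rw [inner_eq_sum_mul x h.1]
    push_cast
    rw [sub_mul, Finset.sum_mul]
    congr 1
    exact Finset.sum_congr rfl fun i _ => by ring
  · have h1 : HasFDerivAt (fun z : EuclideanSpace ℝ (Fin n) × ℝ => (inner ℝ x z.1 - z.2 : ℝ))
        (ℓ x) z := (ℓ x).hasFDerivAt
    have h2 := (ψ.hasDerivAt (inner ℝ x z.1 - z.2)).hasFDerivAt.comp z h1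
    have h3 := ((Complex.conjCLE.toContinuousLinearMap.hasFDerivAt).comp z h2).const_mul (f x)
    refine h3.congr_fderiv ?_
    refine ContinuousLinearMap.ext fun h => ?_
    simp [hF', derivCLM_apply]
    ring

lemma contDiff_waveInt (f : 𝓢(EuclideanSpace ℝ (Fin n), ℂ)) (ψ : 𝓢(ℝ, ℂ)) :
    ContDiff ℝ ∞ (waveInt f ψ) := by
  refine contDiff_infty.mpr fun k => ?_
  induction k generalizing f ψ with
  | zero =>
    exact contDiff_zero.mpr
      (continuous_iff_continuousAt.mpr fun z => (hasFDerivAt_waveInt f ψ z).continuousAt)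
  | succ k ih =>
    refine contDiff_succ_iff_hasFDerivAt.mpr ⟨waveIntDeriv f ψ, ?_, hasFDerivAt_waveInt f ψ⟩
    exact (ContDiff.sum fun i _ => contDiff_const.smulRight (ih _ _)).sub
      (contDiff_const.smulRight (ih _ _))

/-- Multiplication by `c` is absorbed by multiplying `f` or `ψ` by their variables, since
`c = x · v - (x · v - c)`. -/
lemma snd_mul_waveInt (f : 𝓢(EuclideanSpace ℝ (Fin n), ℂ)) (ψ : 𝓢(ℝ, ℂ))
    (z : EuclideanSpace ℝ (Fin n) × ℝ) : (z.2 : ℂ) * waveInt f ψ z =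
      (∑ i, (z.1 i : ℂ) * waveInt (coordMul i f) ψ z) - waveInt f (lineMul ψ) z := by
  simp only [waveInt]
  simp_rw [← integral_const_mul]
  rw [← integral_finsetSum _ fun i _ => (integrable_mul_wave _ _ z).const_mul _,
    ← integral_sub (integrable_finsetSum _ fun i _ => (integrable_mul_wave _ _ z).const_mul _)
      (integrable_mul_wave _ _ z)]
  congr 1
  funext x
  have h : (z.2 : ℂ) = (∑ i, (z.1 i : ℂ) * (x i : ℂ)) - ((inner ℝ x z.1 - z.2 : ℝ) : ℂ) := by
    rw [inner_eq_sum_mul]; push_cast; ring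
  simp only [coordMul_apply, lineMul_apply, map_mul, Complex.conj_ofReal]
  conv_lhs => rw [h]
  rw [sub_mul, Finset.sum_mul]
  congr 1
  · exact Finset.sum_congr rfl fun i _ => by ring
  · ring

/-! ### Decay of the plane wave integral -/

/-- Integration by parts in the direction `v`. -/
lemma norm_sq_mul_waveInt (f : 𝓢(EuclideanSpace ℝ (Fin n), ℂ)) (ψ : 𝓢(ℝ, ℂ))
    (z : EuclideanSpace ℝ (Fin n) × ℝ) :
    ((‖z.1‖ ^ 2 : ℝ) : ℂ) * waveInt f (derivCLM ℂ ℂ ψ) z =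
      -waveInt (LineDeriv.lineDerivOpCLM ℂ _ z.1 f) ψ z := by
  set g : EuclideanSpace ℝ (Fin n) → ℂ := fun x => starRingEnd ℂ (ψ (inner ℝ x z.1 - z.2)) with hg
  have hgd : ∀ x, HasFDerivAt g (Complex.conjCLE.toContinuousLinearMap.comp
      ((ContinuousLinearMap.toSpanSingleton ℝ (deriv ψ (inner ℝ x z.1 - z.2))).comp
        (innerSL ℝ z.1))) x := by
    intro x
    have h1 : HasFDerivAt (fun x : EuclideanSpace ℝ (Fin n) => (inner ℝ x z.1 - z.2 : ℝ))
        (innerSL ℝ z.1) x := by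
      simp_rw [fun x : EuclideanSpace ℝ (Fin n) => real_inner_comm z.1 x]
      exact ((innerSL ℝ z.1).hasFDerivAt).sub_const _
    exact (Complex.conjCLE.toContinuousLinearMap.hasFDerivAt).comp x
      ((ψ.hasDerivAt (inner ℝ x z.1 - z.2)).hasFDerivAt.comp x h1)
  have hgv : ∀ x, fderiv ℝ g x z.1 =
      ((‖z.1‖ ^ 2 : ℝ) : ℂ) * starRingEnd ℂ (derivCLM ℂ ℂ ψ (inner ℝ x z.1 - z.2)) := by
    intro x
    rw [(hgd x).fderiv]
    simp [derivCLM_apply]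
  have key := integral_mul_fderiv_eq_neg_fderiv_mul_of_integrable (𝕜 := ℂ) (μ := volume)
    (f := f) (g := g) (v := z.1) ?_ ?_ ?_ (fun x _ => f.differentiableAt)
    fun x _ => (hgd x).differentiableAt
  · simp only [waveInt]
    simp_rw [hgv, mul_left_comm] at key
    rw [← integral_const_mul]
    exact key
  · exact integrable_mul_wave (LineDeriv.lineDerivOpCLM ℂ _ z.1 f) ψ z
  · simp_rw [hgv, mul_left_comm]
    exact (integrable_mul_wave f (derivCLM ℂ ℂ ψ) z).const_mul _
  · exact integrable_mul_wave f ψ z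

lemma lineDerivOp_eq_sum (v : EuclideanSpace ℝ (Fin n)) (f : 𝓢(EuclideanSpace ℝ (Fin n), ℂ)) :
    LineDeriv.lineDerivOpCLM ℂ _ v f = ∑ i, (v i : ℂ) •
      LineDeriv.lineDerivOpCLM ℂ 𝓢(EuclideanSpace ℝ (Fin n), ℂ)
        (EuclideanSpace.single i (1 : ℝ)) f := by
  refine SchwartzMap.ext fun x => ?_
  have hv : v = ∑ i, v i • EuclideanSpace.single i (1 : ℝ) := by
    simpa using ((EuclideanSpace.basisFun (Fin n) ℝ).sum_repr v).symm
  have hs : ∀ (s : Finset (Fin n)) (g : Fin n → 𝓢(EuclideanSpace ℝ (Fin n), ℂ)),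
      (∑ i ∈ s, g i) x = ∑ i ∈ s, g i x := fun s g => by
    classical
    induction s using Finset.induction_on with
    | empty => simp
    | insert i s hi ih => simp [Finset.sum_insert hi, ih]
  rw [hs]
  simp only [LineDeriv.lineDerivOpCLM_apply, lineDerivOp_apply_eq_fderiv, _root_.smul_apply]
  conv_lhs => rw [hv, map_sum]
  simp

/-- Vanishing moments of `ψ` give decay as `|v| → ∞`: each antiderivative of `ψ` gains a factor
`1 / |v|` through integration by parts. -/
lemma dominated_pow_norm_mul_waveInt (N : ℕ) :
    Dominated fun (f : 𝓢(EuclideanSpace ℝ (Fin n), ℂ)) (ψ : lizorkinLine)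
      (z : EuclideanSpace ℝ (Fin n) × ℝ) => ‖z.1‖ ^ N * ‖waveInt f ψ.1 z‖ := by
  induction N with
  | zero =>
    simpa using dominated_waveInt.comp (ContinuousLinearMap.id ℂ _) lizorkinLine.subtypeL
  | succ N ih =>
    refine (Dominated.sum Finset.univ fun i : Fin n => ih.comp
      (LineDeriv.lineDerivOpCLM ℂ 𝓢(EuclideanSpace ℝ (Fin n), ℂ) (EuclideanSpace.single i (1 : ℝ)))
      lizPrimitive).mono fun f ψ z => ?_
    by_cases hz : ‖z.1‖ = 0
    · rw [hz, zero_pow N.succ_ne_zero, zero_mul]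
      positivity
    · have h1 := norm_sq_mul_waveInt f (lizPrimitive ψ).1 z
      rw [derivCLM_lizPrimitive, lineDerivOp_eq_sum, waveInt_sum_left] at h1
      have h2 : ‖z.1‖ ^ 2 * ‖waveInt f ψ.1 z‖ ≤ ∑ i : Fin n, ‖z.1‖ * ‖waveInt
          (LineDeriv.lineDerivOpCLM ℂ 𝓢(EuclideanSpace ℝ (Fin n), ℂ)
            (EuclideanSpace.single i (1 : ℝ)) f)
          (lizPrimitive ψ).1 z‖ := by
        have h3 : ‖((‖z.1‖ ^ 2 : ℝ) : ℂ) * waveInt f ψ.1 z‖ = ‖z.1‖ ^ 2 * ‖waveInt f ψ.1 z‖ := by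
          simp
        rw [← h3, h1, norm_neg]
        refine (norm_sum_le _ _).trans (Finset.sum_le_sum fun i _ => ?_)
        rw [waveInt_smul_left, norm_mul, Complex.norm_real]
        exact mul_le_mul_of_nonneg_right (PiLp.norm_apply_le z.1 i) (norm_nonneg _)
      rw [← Finset.mul_sum, pow_two, mul_assoc] at h2
      have h4 := le_of_mul_le_mul_left h2 (lt_of_le_of_ne (norm_nonneg _) (Ne.symm hz))
      rw [← Finset.mul_sum, pow_succ, mul_assoc]
      exact mul_le_mul_of_nonneg_left h4 (by positivity)

/-- Vanishing moments of `f` give decay as `v → 0`: the integral vanishes at `v = 0`, and each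
derivative in `v` is again such an integral, so the mean value theorem gains a factor `|v|`. -/
lemma dominated_waveInt_le_pow (N : ℕ) :
    ∃ (p : Seminorm ℂ (lizorkin n)) (q : Seminorm ℂ 𝓢(ℝ, ℂ)), Continuous p ∧ Continuous q ∧
      ∀ f ψ z, ‖waveInt f.1 ψ z‖ ≤ ‖z.1‖ ^ N * (p f * q ψ) := by
  induction N with
  | zero =>
    simpa [Dominated] using dominated_waveInt.comp (lizorkin n).subtypeL
      (ContinuousLinearMap.id ℂ 𝓢(ℝ, ℂ))
  | succ N ih =>
    obtain ⟨p, q, hp, hq, h⟩ := ih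
    have hD : Dominated fun (f : lizorkin n) (ψ : 𝓢(ℝ, ℂ)) (_ : Unit) => p f * q ψ :=
      ⟨p, q, hp, hq, fun _ _ _ => le_rfl⟩
    obtain ⟨p', q', hp', hq', h'⟩ := Dominated.sum Finset.univ fun i : Fin n =>
      hD.comp (lizCoordMul i) (derivCLM ℂ ℂ)
    refine ⟨p', q', hp', hq', fun f ψ ⟨v, c⟩ => ?_⟩
    have hd : ∀ w, HasFDerivAt (fun v => waveInt f.1 ψ (v, c))
        ((waveIntDeriv f.1 ψ (w, c)).comp (ContinuousLinearMap.inl ℝ _ _)) w := fun w =>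
      HasFDerivAt.comp w (f := fun v : EuclideanSpace ℝ (Fin n) => (v, c))
        (hasFDerivAt_waveInt f.1 ψ (w, c)) ((hasFDerivAt_id w).prodMk (hasFDerivAt_const c w))
    have hb : ∀ w ∈ Metric.closedBall (0 : EuclideanSpace ℝ (Fin n)) ‖v‖,
        ‖(waveIntDeriv f.1 ψ (w, c)).comp (ContinuousLinearMap.inl ℝ _ _)‖ ≤
          ‖v‖ ^ N * (p' f * q' ψ) := by
      intro w hw
      rw [mem_closedBall_zero_iff] at hw
      refine ContinuousLinearMap.opNorm_le_bound _ (mul_nonneg (by positivity)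
        (mul_nonneg (apply_nonneg _ _) (apply_nonneg _ _))) fun e => ?_
      rw [ContinuousLinearMap.comp_apply, waveIntDeriv_apply]
      simp only [ContinuousLinearMap.inl_apply, Complex.ofReal_zero, zero_mul, sub_zero]
      refine (norm_sum_le _ _).trans (le_trans (Finset.sum_le_sum (g := fun i =>
        ‖e‖ * (‖v‖ ^ N * (p (lizCoordMul i f) * q (derivCLM ℂ ℂ ψ)))) fun i _ => ?_) ?_)
      · rw [norm_mul, Complex.norm_real]
        refine mul_le_mul (PiLp.norm_apply_le e i)
          ((h (lizCoordMul i f) (derivCLM ℂ ℂ ψ) (w, c)).trans ?_) (norm_nonneg _) (norm_nonneg _)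
        exact mul_le_mul_of_nonneg_right (pow_le_pow_left₀ (norm_nonneg _) hw N)
          (mul_nonneg (apply_nonneg _ _) (apply_nonneg _ _))
      · rw [← Finset.mul_sum, ← Finset.mul_sum, mul_comm]
        gcongr
        exact h' f ψ ()
    have hc := convex_closedBall (0 : EuclideanSpace ℝ (Fin n)) ‖v‖
    have hm := hc.norm_image_sub_le_of_norm_hasFDerivWithin_le
      (fun w _ => (hd w).hasFDerivWithinAt) hb
      (Metric.mem_closedBall_self (norm_nonneg v)) (y := v) (by simp)
    have h0 : waveInt f.1 ψ (0, c) = 0 := by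
      have : ∫ x, f.1 x = 0 := by simpa using f.2 0
      simp [waveInt, integral_mul_const, this]
    rw [h0, sub_zero, sub_zero] at hm
    calc ‖waveInt f.1 ψ (v, c)‖ ≤ _ := hm
      _ = _ := by simp only [pow_succ]; ring

/-! ### Coefficients -/

/-- The algebra of functions of `(w, b, a)` generated by the constants, the coordinates of `w`,
`1 / |w|`, `b` and `1 / a`. On `(ℝⁿ ∖ {0}) × ℝ × ℝ₊` it is closed under derivatives. -/
inductive IsCoef : (EuclideanSpace ℝ (Fin n) × ℝ × ℝ → ℝ) → Prop
  | const (r : ℝ) : IsCoef fun _ => r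
  | coord (i : Fin n) : IsCoef fun p => p.1 i
  | invNorm : IsCoef fun p => ‖p.1‖⁻¹
  | transl : IsCoef fun p => p.2.1
  | invScale : IsCoef fun p => p.2.2⁻¹
  | add {c d} : IsCoef c → IsCoef d → IsCoef fun p => c p + d p
  | mul {c d} : IsCoef c → IsCoef d → IsCoef fun p => c p * d p

lemma IsCoef.sum {κ : Type*} (s : Finset κ) {c : κ → EuclideanSpace ℝ (Fin n) × ℝ × ℝ → ℝ}
    (h : ∀ i, IsCoef (c i)) : IsCoef fun p => ∑ i ∈ s, c i p := by
  classical
  induction s using Finset.induction_on with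
  | empty => simpa using IsCoef.const 0
  | insert i s hi ih => simpa [Finset.sum_insert hi] using (h i).add ih

lemma contDiffAt_invNorm_fst {p : EuclideanSpace ℝ (Fin n) × ℝ × ℝ} (hp : p.1 ≠ 0) :
    ContDiffAt ℝ ∞ (fun p : EuclideanSpace ℝ (Fin n) × ℝ × ℝ => ‖p.1‖⁻¹) p :=
  ((contDiffAt_norm ℝ hp).comp p contDiffAt_fst).inv (norm_ne_zero_iff.mpr hp)

lemma IsCoef.contDiffAt {c : EuclideanSpace ℝ (Fin n) × ℝ × ℝ → ℝ} (hc : IsCoef c)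
    {p : EuclideanSpace ℝ (Fin n) × ℝ × ℝ} (hp : p ∈ amb n) : ContDiffAt ℝ ∞ c p := by
  induction hc with
  | const r => exact contDiffAt_const
  | coord i =>
    exact ((EuclideanSpace.proj i : EuclideanSpace ℝ (Fin n) →L[ℝ] ℝ).contDiff.comp
      contDiff_fst).contDiffAt
  | invNorm => exact contDiffAt_invNorm_fst hp.1
  | transl => exact (contDiff_fst.comp contDiff_snd).contDiffAt
  | invScale => exact (contDiff_snd.comp contDiff_snd).contDiffAt.inv hp.2.ne'
  | add _ _ h h' => exact h.add h'
  | mul _ _ h h' => exact h.mul h'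

lemma IsCoef.differentiableAt {c : EuclideanSpace ℝ (Fin n) × ℝ × ℝ → ℝ} (hc : IsCoef c)
    {p : EuclideanSpace ℝ (Fin n) × ℝ × ℝ} (hp : p ∈ amb n) : DifferentiableAt ℝ c p :=
  (hc.contDiffAt hp).differentiableAt (by simp)

lemma fderiv_invNorm_fst {p : EuclideanSpace ℝ (Fin n) × ℝ × ℝ} (hp : p.1 ≠ 0)
    (v : EuclideanSpace ℝ (Fin n) × ℝ × ℝ) :
    fderiv ℝ (fun p : EuclideanSpace ℝ (Fin n) × ℝ × ℝ => ‖p.1‖⁻¹) p v =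
      -1 * (‖p.1‖⁻¹ * ‖p.1‖⁻¹ * ‖p.1‖⁻¹) * ∑ i, p.1 i * v.1 i := by
  have h1 : HasFDerivAt (fun p : EuclideanSpace ℝ (Fin n) × ℝ × ℝ => ‖p.1‖ ^ 2)
      ((2 • innerSL ℝ p.1).comp (ContinuousLinearMap.fst ℝ _ _)) p :=
    (hasStrictFDerivAt_norm_sq p.1).hasFDerivAt.comp p hasFDerivAt_fst
  have h0 : ‖p.1‖ ≠ 0 := norm_ne_zero_iff.mpr hp
  have hd : DifferentiableAt ℝ (fun p : EuclideanSpace ℝ (Fin n) × ℝ × ℝ => ‖p.1‖⁻¹) p :=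
    (contDiffAt_invNorm_fst hp).differentiableAt (by simp)
  -- Differentiate the identity `|w|⁻² |w|² = 1`.
  have h2 := ((hd.hasFDerivAt.pow 2).mul h1).congr_of_eventuallyEq
    (f₁ := fun _ => (1 : ℝ)) (by
      filter_upwards [(isOpen_ne.preimage continuous_fst).mem_nhds hp] with q hq
      have : ‖q.1‖ ≠ 0 := norm_ne_zero_iff.mpr hq
      simp [this])
  have h3 := congrArg (fun L => L v) (h2.unique (hasFDerivAt_const (1 : ℝ) p))
  have h4 : inner ℝ p.1 v.1 = ∑ i, p.1 i * v.1 i := by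
    rw [real_inner_comm, inner_eq_sum_mul]
  simp [h4] at h3
  set D := fderiv ℝ (fun p : EuclideanSpace ℝ (Fin n) × ℝ × ℝ => ‖p.1‖⁻¹) p v
  field_simp at h3 ⊢
  linarith

lemma IsCoef.exists_fderiv {c : EuclideanSpace ℝ (Fin n) × ℝ × ℝ → ℝ} (hc : IsCoef c)
    (v : EuclideanSpace ℝ (Fin n) × ℝ × ℝ) :
    ∃ c', IsCoef c' ∧ ∀ p ∈ amb n, fderiv ℝ c p v = c' p := by
  induction hc with
  | const r => exact ⟨_, .const 0, fun p _ => by simp⟩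
  | coord i =>
    refine ⟨_, .const (v.1 i), fun p _ => ?_⟩
    exact congrArg (fun L => L v) (((EuclideanSpace.proj i : EuclideanSpace ℝ (Fin n) →L[ℝ] ℝ).comp
      (ContinuousLinearMap.fst ℝ _ _)).fderiv (x := p))
  | invNorm =>
    exact ⟨_, ((IsCoef.const (-1)).mul ((IsCoef.invNorm.mul .invNorm).mul .invNorm)).mul
      (IsCoef.sum Finset.univ fun i => (IsCoef.coord i).mul (.const (v.1 i))),
      fun p hp => fderiv_invNorm_fst hp.1 v⟩
  | transl =>
    refine ⟨_, .const v.2.1, fun p _ => ?_⟩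
    exact congrArg (fun L => L v) (((ContinuousLinearMap.fst ℝ ℝ ℝ).comp
      (ContinuousLinearMap.snd ℝ (EuclideanSpace ℝ (Fin n)) _)).fderiv (x := p))
  | invScale =>
    refine ⟨_, (IsCoef.invScale.mul .invScale).mul (.const (-v.2.2)), fun p hp => ?_⟩
    have h1 : HasFDerivAt (fun p : EuclideanSpace ℝ (Fin n) × ℝ × ℝ => p.2.2)
      ((ContinuousLinearMap.snd ℝ ℝ ℝ).comp (ContinuousLinearMap.snd ℝ _ _)) p :=
      hasFDerivAt_snd.comp p hasFDerivAt_snd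
    have h2 := ((hasDerivAt_inv hp.2.ne').hasFDerivAt.comp p h1).fderiv
    refine (congrArg (fun L => L v) h2).trans ?_
    simp [pow_two]
    ring
  | add hc hd ihc ihd =>
    obtain ⟨c', hc', h⟩ := ihc
    obtain ⟨d', hd', h'⟩ := ihd
    refine ⟨_, hc'.add hd', fun p hp => ?_⟩
    rw [fderiv_fun_add (hc.differentiableAt hp) (hd.differentiableAt hp), ← h p hp, ← h' p hp]
    rfl
  | @mul c d hc hd ihc ihd =>
    obtain ⟨c', hc', h⟩ := ihc
    obtain ⟨d', hd', h'⟩ := ihd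
    refine ⟨_, (hc.mul hd').add (hd.mul hc'), fun p hp => ?_⟩
    rw [fderiv_fun_mul (hc.differentiableAt hp) (hd.differentiableAt hp), ← h p hp, ← h' p hp]
    rfl

/-- The map `(w, b, a) ↦ (w / |w|, b, a)`. -/
def normalizeFst (p : EuclideanSpace ℝ (Fin n) × ℝ × ℝ) : EuclideanSpace ℝ (Fin n) × ℝ × ℝ :=
  (‖p.1‖⁻¹ • p.1, p.2)

lemma IsCoef.exists_normalizeFst {c : EuclideanSpace ℝ (Fin n) × ℝ × ℝ → ℝ} (hc : IsCoef c) :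
    ∃ c', IsCoef c' ∧ ∀ p ∈ amb n, c (normalizeFst p) = c' p := by
  induction hc with
  | const r => exact ⟨_, .const r, fun _ _ => rfl⟩
  | coord i => exact ⟨_, IsCoef.invNorm.mul (.coord i), fun p _ => by simp [normalizeFst]⟩
  | invNorm =>
    refine ⟨_, .const 1, fun p hp => ?_⟩
    have : ‖p.1‖ ≠ 0 := norm_ne_zero_iff.mpr hp.1
    simp [normalizeFst, norm_smul, this]
  | transl => exact ⟨_, .transl, fun _ _ => rfl⟩
  | invScale => exact ⟨_, .invScale, fun _ _ => rfl⟩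
  | add _ _ ihc ihd =>
    obtain ⟨c', hc', h⟩ := ihc
    obtain ⟨d', hd', h'⟩ := ihd
    exact ⟨_, hc'.add hd', fun p hp => congrArg₂ (· + ·) (h p hp) (h' p hp)⟩
  | mul _ _ ihc ihd =>
    obtain ⟨c', hc', h⟩ := ihc
    obtain ⟨d', hd', h'⟩ := ihd
    exact ⟨_, hc'.mul hd', fun p hp => congrArg₂ (· * ·) (h p hp) (h' p hp)⟩

/-! ### Families of wave integrals -/

/-- The point `(w / (|w| a), b / a)` at which the plane wave integral is taken. -/
def wavePoint (p : EuclideanSpace ℝ (Fin n) × ℝ × ℝ) : EuclideanSpace ℝ (Fin n) × ℝ :=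
  ((p.2.2⁻¹ * ‖p.1‖⁻¹) • p.1, p.2.1 * p.2.2⁻¹)

/-- The families, indexed by `(f, ψ)`, of functions of `(w, b, a)` that are finite sums of
plane wave integrals of `A f` and `B ψ`, for continuous operators `A` and `B` on the Lizorkin
spaces, taken at `(w / (|w| a), b / a)` and multiplied by coefficients. They are stable under all
the differential operators in question. -/
inductive IsWave : (lizorkin n → lizorkinLine → EuclideanSpace ℝ (Fin n) × ℝ × ℝ → ℂ) → Prop
  | base {c : EuclideanSpace ℝ (Fin n) × ℝ × ℝ → ℝ} (hc : IsCoef c)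
      (A : lizorkin n →L[ℂ] lizorkin n) (B : lizorkinLine →L[ℂ] lizorkinLine) :
      IsWave fun f ψ p => (c p : ℂ) * waveInt (A f).1 (B ψ).1 (wavePoint p)
  | add {T U} : IsWave T → IsWave U → IsWave fun f ψ p => T f ψ p + U f ψ p

lemma IsWave.sum {κ : Type*} (s : Finset κ)
    {T : κ → lizorkin n → lizorkinLine → EuclideanSpace ℝ (Fin n) × ℝ × ℝ → ℂ}
    (h : ∀ i, IsWave (T i)) : IsWave fun f ψ p => ∑ i ∈ s, T i f ψ p := by
  classical
  induction s using Finset.induction_on with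
  | empty =>
    simpa using IsWave.base (IsCoef.const 0) (.id ℂ (lizorkin n)) (.id ℂ lizorkinLine)
  | insert i s hi ih => simpa [Finset.sum_insert hi] using (h i).add ih

lemma isCoef_wavePoint_fst (i : Fin n) :
    IsCoef fun p : EuclideanSpace ℝ (Fin n) × ℝ × ℝ => (wavePoint p).1 i :=
  (IsCoef.invScale.mul .invNorm).mul (.coord i)

lemma isCoef_wavePoint_snd :
    IsCoef fun p : EuclideanSpace ℝ (Fin n) × ℝ × ℝ => (wavePoint p).2 :=
  IsCoef.transl.mul .invScale

lemma contDiffAt_wavePoint {p : EuclideanSpace ℝ (Fin n) × ℝ × ℝ} (hp : p ∈ amb n) :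
    ContDiffAt ℝ ∞ wavePoint p :=
  (((IsCoef.invScale.mul .invNorm).contDiffAt hp).smul contDiffAt_fst).prodMk
    (isCoef_wavePoint_snd.contDiffAt hp)

lemma IsWave.contDiffAt {T : lizorkin n → lizorkinLine → EuclideanSpace ℝ (Fin n) × ℝ × ℝ → ℂ}
    (hT : IsWave T) (f : lizorkin n) (ψ : lizorkinLine)
    {p : EuclideanSpace ℝ (Fin n) × ℝ × ℝ} (hp : p ∈ amb n) : ContDiffAt ℝ ∞ (T f ψ) p := by
  induction hT with
  | base hc A B =>
    exact (Complex.ofRealCLM.contDiff.contDiffAt.comp p (hc.contDiffAt hp)).mul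
      ((contDiff_waveInt _ _).contDiffAt.comp p (contDiffAt_wavePoint hp))
  | add _ _ h h' => exact h.add h'

lemma IsWave.contDiffOn {T : lizorkin n → lizorkinLine → EuclideanSpace ℝ (Fin n) × ℝ × ℝ → ℂ}
    (hT : IsWave T) (f : lizorkin n) (ψ : lizorkinLine) : ContDiffOn ℝ ∞ (T f ψ) (amb n) :=
  fun _ hp => (hT.contDiffAt f ψ hp).contDiffWithinAt

lemma fderiv_waveInt_wavePoint (f : 𝓢(EuclideanSpace ℝ (Fin n), ℂ)) (ψ : 𝓢(ℝ, ℂ))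
    {p : EuclideanSpace ℝ (Fin n) × ℝ × ℝ} (hp : p ∈ amb n)
    (v : EuclideanSpace ℝ (Fin n) × ℝ × ℝ) :
    fderiv ℝ (fun p => waveInt f ψ (wavePoint p)) p v =
      (∑ i, ((fderiv ℝ (fun p => (wavePoint p).1 i) p v : ℝ) : ℂ) *
        waveInt (coordMul i f) (derivCLM ℂ ℂ ψ) (wavePoint p)) -
        ((fderiv ℝ (fun p => (wavePoint p).2) p v : ℝ) : ℂ) *
          waveInt f (derivCLM ℂ ℂ ψ) (wavePoint p) := by
  have hd : HasFDerivAt wavePoint (fderiv ℝ wavePoint p) p :=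
    ((contDiffAt_wavePoint hp).differentiableAt (by simp)).hasFDerivAt
  have h1 : ∀ i, fderiv ℝ (fun p => (wavePoint p).1 i) p v = (fderiv ℝ wavePoint p v).1 i := by
    intro i
    have := (((EuclideanSpace.proj i : EuclideanSpace ℝ (Fin n) →L[ℝ] ℝ).comp
      (ContinuousLinearMap.fst ℝ _ ℝ)).hasFDerivAt.comp p hd).fderiv
    exact congrArg (fun L => L v) this
  have h2 : fderiv ℝ (fun p => (wavePoint p).2) p v = (fderiv ℝ wavePoint p v).2 := by
    have := ((ContinuousLinearMap.snd ℝ (EuclideanSpace ℝ (Fin n)) ℝ).hasFDerivAt.comp p hd).fderiv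
    exact congrArg (fun L => L v) this
  have h3 := ((hasFDerivAt_waveInt f ψ (wavePoint p)).comp p hd).fderiv
  refine (congrArg (fun L => L v) h3).trans ?_
  rw [ContinuousLinearMap.comp_apply, waveIntDeriv_apply, h2]
  simp_rw [h1]

/-- Differentiating the plane wave integral only replaces `f` by `f` or `x_i f`, and `ψ` by `ψ'`,
which stay in the Lizorkin spaces. -/
lemma IsWave.exists_dirD
    {T : lizorkin n → lizorkinLine → EuclideanSpace ℝ (Fin n) × ℝ × ℝ → ℂ}
    (hT : IsWave T) (v : EuclideanSpace ℝ (Fin n) × ℝ × ℝ) :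
    ∃ T', IsWave T' ∧ ∀ f ψ, Set.EqOn (dirD v (T f ψ)) (T' f ψ) (amb n) := by
  induction hT with
  | @base c hc A B =>
    obtain ⟨c', hc', h⟩ := hc.exists_fderiv v
    choose d hd hdv using fun i => (isCoef_wavePoint_fst (n := n) i).exists_fderiv v
    obtain ⟨e, he, hev⟩ := (isCoef_wavePoint_snd (n := n)).exists_fderiv v
    refine ⟨_, ((IsWave.base hc' A B).add (IsWave.sum Finset.univ fun i =>
      .base (hc.mul (hd i)) ((lizCoordMul i).comp A) (lizDeriv.comp B))).add
        (.base ((hc.mul he).mul (.const (-1))) A (lizDeriv.comp B)), fun f ψ p hp => ?_⟩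
    have h1 : HasFDerivAt (fun p => (c p : ℂ)) (Complex.ofRealCLM.comp (fderiv ℝ c p)) p :=
      Complex.ofRealCLM.hasFDerivAt.comp p (hc.differentiableAt hp).hasFDerivAt
    have h2 : DifferentiableAt ℝ (fun p => waveInt (A f).1 (B ψ).1 (wavePoint p)) p :=
      ((contDiff_waveInt _ _).contDiffAt.comp p (contDiffAt_wavePoint hp)).differentiableAt
        (by simp)
    rw [dirD, fderiv_fun_mul h1.differentiableAt h2, h1.fderiv]
    simp only [_root_.add_apply, _root_.smul_apply, ContinuousLinearMap.comp_apply,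
      fderiv_waveInt_wavePoint _ _ hp, hdv _ p hp, hev p hp, h p hp, smul_eq_mul, mul_sub,
      Finset.mul_sum]
    push_cast
    have e1 : ∀ i, (lizCoordMul i (A f)).1 = coordMul i (A f).1 := fun i => rfl
    have e2 : (lizDeriv (B ψ)).1 = derivCLM ℂ ℂ (B ψ).1 := rfl
    simp only [e1, e2, Complex.ofRealCLM_apply, mul_assoc]
    ring
  | @add T U hT hU ihT ihU =>
    obtain ⟨T', hT', h⟩ := ihT
    obtain ⟨U', hU', h'⟩ := ihU
    refine ⟨_, hT'.add hU', fun f ψ p hp => ?_⟩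
    rw [dirD, fderiv_fun_add (diffAt (hT.contDiffOn f ψ) hp) (diffAt (hU.contDiffOn f ψ) hp)]
    exact congrArg₂ (· + ·) (h f ψ hp) (h' f ψ hp)

lemma wavePoint_normalizeFst {p : EuclideanSpace ℝ (Fin n) × ℝ × ℝ} (hp : p ∈ amb n) :
    wavePoint (normalizeFst p) = wavePoint p := by
  have : ‖p.1‖ ≠ 0 := norm_ne_zero_iff.mpr hp.1
  simp [wavePoint, normalizeFst, norm_smul, this, smul_smul]

lemma IsWave.exists_normalizeFst
    {T : lizorkin n → lizorkinLine → EuclideanSpace ℝ (Fin n) × ℝ × ℝ → ℂ} (hT : IsWave T) :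
    ∃ T', IsWave T' ∧ ∀ f ψ, ∀ p ∈ amb n, T f ψ (normalizeFst p) = T' f ψ p := by
  induction hT with
  | base hc A B =>
    obtain ⟨c', hc', h⟩ := hc.exists_normalizeFst
    exact ⟨_, .base hc' A B, fun f ψ p hp => by
      beta_reduce; rw [wavePoint_normalizeFst hp, h p hp]⟩
  | add _ _ ihT ihU =>
    obtain ⟨T', hT', h⟩ := ihT
    obtain ⟨U', hU', h'⟩ := ihU
    exact ⟨_, hT'.add hU', fun f ψ p hp =>
      congrArg₂ (· + ·) (h f ψ p hp) (h' f ψ p hp)⟩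

/-- The extension to the ambient space that is constant on rays of the restriction to `Y^{n+1}` of
a family of wave integrals is again such a family. -/
lemma IsWave.exists_ext
    {T : lizorkin n → lizorkinLine → EuclideanSpace ℝ (Fin n) × ℝ × ℝ → ℂ} (hT : IsWave T) :
    ∃ T', IsWave T' ∧ ∀ f ψ, Set.EqOn (ext fun y => T f ψ (incl y)) (T' f ψ) (amb n) := by
  obtain ⟨T', hT', h⟩ := hT.exists_normalizeFst
  refine ⟨T', hT', fun f ψ p hp => ?_⟩
  rw [← h f ψ p hp]
  exact dif_pos hp

lemma IsWave.isSmooth [n.AtLeastTwo]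
    {T : lizorkin n → lizorkinLine → EuclideanSpace ℝ (Fin n) × ℝ × ℝ → ℂ}
    (hT : IsWave T) (f : lizorkin n) (ψ : lizorkinLine) :
    IsSmooth fun y : Y n => T f ψ (incl y) :=
  smooth_of_ambient (hT.contDiffOn f ψ)

/-- The operator `P` maps restrictions to `Y^{n+1}` of families of wave integrals to such
restrictions. -/
def PreservesWaves (P : (Y n → ℂ) → Y n → ℂ) : Prop :=
  ∀ T : lizorkin n → lizorkinLine → EuclideanSpace ℝ (Fin n) × ℝ × ℝ → ℂ, IsWave T →
    ∃ T', IsWave T' ∧ ∀ f ψ, P (fun y => T f ψ (incl y)) = fun y => T' f ψ (incl y)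

lemma PreservesWaves.iterate {P : (Y n → ℂ) → Y n → ℂ} (hP : PreservesWaves P) (j : ℕ) :
    PreservesWaves P^[j] := by
  induction j with
  | zero => exact fun T hT => ⟨T, hT, fun _ _ => rfl⟩
  | succ j ih =>
    intro T hT
    obtain ⟨T', hT', h⟩ := hP T hT
    obtain ⟨T'', hT'', h'⟩ := ih T' hT'
    refine ⟨T'', hT'', fun f ψ => ?_⟩
    rw [Function.iterate_succ_apply, h, h']

lemma preservesWaves_opB [n.AtLeastTwo] : PreservesWaves (opB (n := n)) := by
  intro T hT
  obtain ⟨T', hT', h⟩ := hT.exists_ext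
  obtain ⟨T'', hT'', h'⟩ := hT'.exists_dirD (0, 1, 0)
  refine ⟨T'', hT'', fun f ψ => funext fun y => ?_⟩
  rw [opB_eq (hT.isSmooth f ψ), dirD_congr _ (h f ψ) (incl_mem y), h' f ψ (incl_mem y)]

lemma preservesWaves_opA [n.AtLeastTwo] : PreservesWaves (opA (n := n)) := by
  intro T hT
  obtain ⟨T', hT', h⟩ := hT.exists_ext
  obtain ⟨T'', hT'', h'⟩ := hT'.exists_dirD (0, 0, 1)
  refine ⟨T'', hT'', fun f ψ => funext fun y => ?_⟩
  rw [opA_eq (hT.isSmooth f ψ), dirD_congr _ (h f ψ) (incl_mem y), h' f ψ (incl_mem y)]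

lemma preservesWaves_opU [n.AtLeastTwo] : PreservesWaves (opU (n := n)) := by
  intro T hT
  obtain ⟨T', hT', h⟩ := hT.exists_ext
  choose U hU hTU using fun i => hT'.exists_dirD
    (stdOrthonormalBasis ℝ (EuclideanSpace ℝ (Fin n)) i, 0, 0)
  choose V hV hUV using fun i => (hU i).exists_dirD
    (stdOrthonormalBasis ℝ (EuclideanSpace ℝ (Fin n)) i, 0, 0)
  refine ⟨_, IsWave.sum Finset.univ hV, fun f ψ => funext fun y => ?_⟩
  rw [opU_eq (hT.isSmooth f ψ)]
  refine Finset.sum_congr rfl fun i _ => ?_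
  rw [dirD_congr _ ((dirD_congr _ (h f ψ)).trans (hTU i f ψ)) (incl_mem y),
    hUV i f ψ (incl_mem y)]

lemma preservesWaves_diffOp [n.AtLeastTwo] (l m k : ℕ) :
    PreservesWaves (diffOp (n := n) l m k) := by
  intro T hT
  obtain ⟨T₁, hT₁, h₁⟩ := preservesWaves_opU.iterate k T hT
  obtain ⟨T₂, hT₂, h₂⟩ := preservesWaves_opB.iterate m T₁ hT₁
  obtain ⟨T₃, hT₃, h₃⟩ := preservesWaves_opA.iterate l T₂ hT₂
  exact ⟨T₃, hT₃, fun f ψ => by rw [diffOp, h₁, h₂, h₃]⟩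

/-! ### Decay of the families of wave integrals -/

/-- The weight `a^σ |b|^r`, `σ ∈ ℤ`, at the point `(u, b, a)`. -/
def monWeight (σ : ℤ) (r : ℕ) (y : Y n) : ℝ := (y.2.2 : ℝ) ^ σ * |y.2.1| ^ r

lemma scale_pos (y : Y n) : (0 : ℝ) < y.2.2 := y.2.2.2

lemma monWeight_nonneg (σ : ℤ) (r : ℕ) (y : Y n) : 0 ≤ monWeight σ r y :=
  mul_nonneg (zpow_nonneg (scale_pos y).le _) (by positivity)

lemma monWeight_succ (σ : ℤ) (r : ℕ) (y : Y n) :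
    monWeight σ (r + 1) y = monWeight σ r y * |y.2.1| := by
  rw [monWeight, monWeight, pow_succ, mul_assoc]

lemma monWeight_add_one (σ : ℤ) (r : ℕ) (y : Y n) :
    monWeight (σ + 1) r y = monWeight σ r y * y.2.2 := by
  rw [monWeight, monWeight, zpow_add_one₀ (scale_pos y).ne', mul_right_comm]

lemma monWeight_sub_one (σ : ℤ) (r : ℕ) (y : Y n) :
    monWeight (σ - 1) r y = monWeight σ r y * (y.2.2 : ℝ)⁻¹ := by
  rw [monWeight, monWeight, zpow_sub_one₀ (scale_pos y).ne', mul_right_comm]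

/-- `N` is dominated with respect to all weights `a^σ |b|^r`. -/
def RapidlyDominated (N : lizorkin n → lizorkinLine → Y n → ℝ) : Prop :=
  ∀ (σ : ℤ) (r : ℕ), Dominated fun f ψ y => monWeight σ r y * N f ψ y

lemma norm_sphere (u : USphere n) : ‖(u : EuclideanSpace ℝ (Fin n))‖ = 1 :=
  norm_eq_of_mem_sphere u

lemma norm_wavePoint_incl_fst (y : Y n) : ‖(wavePoint (incl y)).1‖ = (y.2.2 : ℝ)⁻¹ := by
  have := scale_pos y
  simp [wavePoint, incl, norm_smul, abs_of_pos this]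

/-- For `r = 0` this is the decay as `v → 0` or as `|v| → ∞`, since `|v| = 1 / a` at
`v = u / a`; each factor `b = a c` is then absorbed by `f` and `ψ`. -/
lemma rapidlyDominated_waveInt : RapidlyDominated fun (f : lizorkin n) (ψ : lizorkinLine) y =>
    ‖waveInt f.1 ψ.1 (wavePoint (incl y))‖ := by
  intro σ r
  induction r generalizing σ with
  | zero =>
    rcases Int.eq_nat_or_neg σ with ⟨N, rfl | rfl⟩
    · obtain ⟨p, q, hp, hq, h⟩ := dominated_waveInt_le_pow (n := n) N
      refine ⟨p, q.comp lizorkinLine.subtype, hp, hq.comp continuous_subtype_val,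
        fun f ψ y => ?_⟩
      have ha := scale_pos y
      have h1 := h f ψ.1 (wavePoint (incl y))
      rw [norm_wavePoint_incl_fst, inv_pow] at h1
      simp only [monWeight, pow_zero, mul_one, zpow_natCast]
      exact (le_inv_mul_iff₀ (pow_pos ha N)).mp h1
    · obtain ⟨p, q, hp, hq, h⟩ := (dominated_pow_norm_mul_waveInt (n := n) N).comp
        (lizorkin n).subtypeL (ContinuousLinearMap.id ℂ lizorkinLine)
      refine ⟨p, q, hp, hq, fun f ψ y => ?_⟩
      have h1 := h f ψ (wavePoint (incl y))
      simp only [norm_wavePoint_incl_fst, inv_pow] at h1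
      simp only [monWeight, pow_zero, mul_one, zpow_neg, zpow_natCast]
      exact h1
  | succ r ih =>
    refine ((Dominated.sum Finset.univ fun i : Fin n =>
      (ih σ).comp (lizCoordMul i) (.id ℂ lizorkinLine)).add
        ((ih (σ + 1)).comp (.id ℂ (lizorkin n)) lizLineMul)).mono fun f ψ y => ?_
    have ha := scale_pos y
    have h1 := snd_mul_waveInt f.1 ψ.1 (wavePoint (incl y))
    have hb : |y.2.1| = y.2.2 * |(wavePoint (incl y)).2| := by
      rw [wavePoint, incl, abs_mul, abs_inv, abs_of_pos ha]
      field_simp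
    have h2 : |(wavePoint (incl y)).2| * ‖waveInt f.1 ψ.1 (wavePoint (incl y))‖ ≤
        (∑ i, (y.2.2 : ℝ)⁻¹ * ‖waveInt (coordMul i f.1) ψ.1 (wavePoint (incl y))‖) +
          ‖waveInt f.1 (lineMul ψ.1) (wavePoint (incl y))‖ := by
      have h3 := congrArg norm h1
      rw [norm_mul, Complex.norm_real, Real.norm_eq_abs] at h3
      rw [h3]
      refine (norm_sub_le _ _).trans (add_le_add_left ((norm_sum_le _ _).trans
        (Finset.sum_le_sum fun i _ => ?_)) _)
      rw [norm_mul, Complex.norm_real, ← norm_wavePoint_incl_fst]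
      exact mul_le_mul_of_nonneg_right (PiLp.norm_apply_le _ i) (norm_nonneg _)
    rw [← Finset.mul_sum] at h2
    rw [monWeight_succ, ← Finset.mul_sum, monWeight_add_one, mul_assoc, mul_assoc, ← mul_add]
    refine mul_le_mul_of_nonneg_left ?_ (monWeight_nonneg σ r y)
    rw [hb, mul_assoc]
    refine (mul_le_mul_of_nonneg_left h2 ha.le).trans_eq ?_
    rw [mul_add, mul_inv_cancel_left₀ ha.ne']
    rfl

lemma RapidlyDominated.coef_mul {c : EuclideanSpace ℝ (Fin n) × ℝ × ℝ → ℝ} (hc : IsCoef c)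
    {N : lizorkin n → lizorkinLine → Y n → ℝ} (hN : RapidlyDominated N)
    (h0 : ∀ f ψ y, 0 ≤ N f ψ y) : RapidlyDominated fun f ψ y => |c (incl y)| * N f ψ y := by
  induction hc generalizing N with
  | const t =>
    exact fun σ r => ((hN σ r).const_mul ⟨|t|, abs_nonneg t⟩).mono fun f ψ y =>
      (mul_left_comm _ _ _).le
  | coord i =>
    refine fun σ r => (hN σ r).mono fun f ψ y => ?_
    refine mul_le_mul_of_nonneg_left (mul_le_of_le_one_left (h0 f ψ y) ?_)
      (monWeight_nonneg σ r y)
    exact (PiLp.norm_apply_le (y.1 : EuclideanSpace ℝ (Fin n)) i).trans (norm_sphere y.1).le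
  | invNorm => simpa [incl] using hN
  | transl =>
    refine fun σ r => (hN σ (r + 1)).mono fun f ψ y => ?_
    rw [monWeight_succ, mul_assoc]
    rfl
  | invScale =>
    refine fun σ r => (hN (σ - 1) r).mono fun f ψ y => ?_
    rw [monWeight_sub_one, mul_assoc, ← abs_of_pos (inv_pos.mpr (scale_pos y))]
    rfl
  | add _ _ hc hd =>
    refine fun σ r => ((hc hN h0 σ r).add (hd hN h0 σ r)).mono fun f ψ y => ?_
    rw [← mul_add, ← add_mul]
    exact mul_le_mul_of_nonneg_left (mul_le_mul_of_nonneg_right (abs_add_le _ _) (h0 f ψ y))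
      (monWeight_nonneg σ r y)
  | mul _ _ hc hd =>
    simpa only [abs_mul, mul_assoc] using
      hc (hd hN h0) fun f ψ y => mul_nonneg (abs_nonneg _) (h0 f ψ y)

lemma IsWave.rapidlyDominated
    {T : lizorkin n → lizorkinLine → EuclideanSpace ℝ (Fin n) × ℝ × ℝ → ℂ} (hT : IsWave T) :
    RapidlyDominated fun f ψ y => ‖T f ψ (incl y)‖ := by
  induction hT with
  | base hc A B =>
    have h := RapidlyDominated.coef_mul hc
      (fun σ r => (rapidlyDominated_waveInt σ r).comp A B) fun f ψ y => norm_nonneg _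
    simpa only [norm_mul, Complex.norm_real, Real.norm_eq_abs] using h
  | add _ _ hT hU =>
    refine fun σ r => ((hT σ r).add (hU σ r)).mono fun f ψ y => ?_
    rw [← mul_add]
    exact mul_le_mul_of_nonneg_left (norm_add_le _ _) (monWeight_nonneg σ r y)

lemma weight_le_monWeight (s r : ℕ) (y : Y n) :
    ((y.2.2 : ℝ) ^ s + 1 / (y.2.2 : ℝ) ^ s) * (1 + y.2.1 ^ 2) ^ ((r : ℝ) / 2) ≤
      2 ^ (r - 1) * (monWeight s 0 y + monWeight s (2 * r) y + monWeight (-s) 0 y +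
        monWeight (-s) (2 * r) y) := by
  have ha := scale_pos y
  have hb : (1 : ℝ) ≤ 1 + y.2.1 ^ 2 := le_add_of_nonneg_right (sq_nonneg _)
  have h1 : (1 + y.2.1 ^ 2) ^ ((r : ℝ) / 2) ≤ 2 ^ (r - 1) * (1 + |y.2.1| ^ (2 * r)) := by
    calc (1 + y.2.1 ^ 2) ^ ((r : ℝ) / 2) ≤ (1 + y.2.1 ^ 2) ^ (r : ℝ) :=
          Real.rpow_le_rpow_of_exponent_le hb (half_le_self r.cast_nonneg)
      _ = (1 + y.2.1 ^ 2) ^ r := Real.rpow_natCast _ _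
      _ ≤ 2 ^ (r - 1) * (1 ^ r + (y.2.1 ^ 2) ^ r) := add_pow_le zero_le_one (sq_nonneg _) r
      _ = _ := by rw [one_pow, ← sq_abs, pow_mul]
  refine (mul_le_mul_of_nonneg_left h1 (by positivity)).trans_eq ?_
  simp only [monWeight, zpow_neg, zpow_natCast, one_div]
  ring

/-- The weighted derivatives of the restriction to `Y^{n+1}` of a family of wave integrals are
dominated by continuous seminorms of `f` and `ψ`. -/
lemma IsWave.dominated_weighted [n.AtLeastTwo]
    {T : lizorkin n → lizorkinLine → EuclideanSpace ℝ (Fin n) × ℝ × ℝ → ℂ} (hT : IsWave T)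
    (s r l m k : ℕ) :
    Dominated fun f ψ => weighted s r l m k fun y : Y n => T f ψ (incl y) := by
  obtain ⟨U, hU, h⟩ := preservesWaves_diffOp l m k T hT
  have hd := hU.rapidlyDominated
  refine (((((hd s 0).add (hd s (2 * r))).add (hd (-s) 0)).add
    (hd (-s) (2 * r))).const_mul (2 ^ (r - 1))).mono fun f ψ y => ?_
  rw [weighted, h]
  refine (mul_le_mul_of_nonneg_right (weight_le_monWeight s r y) (norm_nonneg _)).trans_eq ?_
  push_cast
  ring

/-! ### The ridgelet transform -/

lemma ridgeletTransform_eq (f : 𝓢(EuclideanSpace ℝ (Fin n), ℂ)) (ψ : 𝓢(ℝ, ℂ)) (y : Y n) :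
    ridgeletTransform ψ f y =
      (((y.2.2 : ℝ)⁻¹ : ℝ) : ℂ) * waveInt f ψ (wavePoint (incl y)) := by
  rw [ridgeletTransform, waveInt, ← integral_const_mul]
  congr 1
  funext x
  have h : (inner ℝ x (y.1 : EuclideanSpace ℝ (Fin n)) - y.2.1) / (y.2.2 : ℝ) =
      inner ℝ x (wavePoint (incl y)).1 - (wavePoint (incl y)).2 := by
    simp only [wavePoint, incl, norm_sphere, inv_one, mul_one, inner_smul_right]
    ring
  rw [ridgelet, h, map_mul, one_div, ← Complex.ofReal_inv, Complex.conj_ofReal]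
  ring

/-- The ridgelet transform as a family of wave integrals. -/
def ridgeletWave (f : lizorkin n) (ψ : lizorkinLine) (p : EuclideanSpace ℝ (Fin n) × ℝ × ℝ) : ℂ :=
  ((p.2.2⁻¹ : ℝ) : ℂ) * waveInt f.1 ψ.1 (wavePoint p)

lemma isWave_ridgeletWave : IsWave (ridgeletWave (n := n)) :=
  IsWave.base .invScale (.id ℂ (lizorkin n)) (.id ℂ lizorkinLine)

/-- The ridgelet transform as an element of `S(Y^{n+1})`. -/
def ridgeletSY [n.AtLeastTwo] (f : lizorkin n) (ψ : lizorkinLine) : SY n :=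
  ⟨fun y => ridgeletWave f ψ (incl y), isWave_ridgeletWave.isSmooth f ψ, fun s r l m k => by
    obtain ⟨p, q, -, -, h⟩ := (isWave_ridgeletWave (n := n)).dominated_weighted s r l m k
    exact ⟨p f * q ψ, by rintro _ ⟨y, rfl⟩; exact h f ψ y⟩⟩

lemma SY_ext [n.AtLeastTwo] {Φ Ψ : SY n} (h : ∀ y, Φ y = Ψ y) : Φ = Ψ :=
  Subtype.ext (funext h)

lemma ridgeletSY_apply [n.AtLeastTwo] (f : lizorkin n) (ψ : lizorkinLine) (y : Y n) :
    ridgeletSY f ψ y = ((((incl y).2.2)⁻¹ : ℝ) : ℂ) * waveInt f.1 ψ.1 (wavePoint (incl y)) := rfl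

/-- The ridgelet transform as a sesquilinear map. -/
def ridgeletLM (n : ℕ) [n.AtLeastTwo] : lizorkin n →ₗ[ℂ] lizorkinLine →ₗ⋆[ℂ] SY n :=
  LinearMap.mk₂'ₛₗ (RingHom.id ℂ) (starRingEnd ℂ) ridgeletSY
    (fun f g ψ => SY_ext fun y => by
      change _ = ridgeletSY f ψ y + ridgeletSY g ψ y
      simp only [ridgeletSY_apply, Submodule.coe_add, waveInt_add_left, mul_add])
    (fun c f ψ => SY_ext fun y => by
      change _ = c * ridgeletSY f ψ y
      simp only [ridgeletSY_apply, Submodule.coe_smul, waveInt_smul_left, mul_left_comm])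
    (fun f ψ χ => SY_ext fun y => by
      change _ = ridgeletSY f ψ y + ridgeletSY f χ y
      simp only [ridgeletSY_apply, Submodule.coe_add, waveInt_add_right, mul_add])
    (fun c f ψ => SY_ext fun y => by
      change _ = starRingEnd ℂ c * ridgeletSY f ψ y
      simp only [ridgeletSY_apply, Submodule.coe_smul, waveInt_smul_right, mul_left_comm])

lemma exists_rho_ridgeletLM_le [n.AtLeastTwo] (i : ℕ × ℕ × ℕ × ℕ × ℕ) :
    ∃ (p : Seminorm ℂ (lizorkin n)) (q : Seminorm ℂ lizorkinLine), Continuous p ∧ Continuous q ∧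
      ∀ f ψ, rhoFamily n i (ridgeletLM n f ψ) ≤ p f * q ψ := by
  obtain ⟨s, r, l, m, k⟩ := i
  obtain ⟨p, q, hp, hq, h⟩ := (isWave_ridgeletWave (n := n)).dominated_weighted s r l m k
  exact ⟨p, q, hp, hq, fun f ψ => Real.iSup_le (fun y => h f ψ y)
    (mul_nonneg (apply_nonneg _ _) (apply_nonneg _ _))⟩

/-- Joint continuity: `R f ψ - R f₀ ψ₀ = R (f - f₀) ψ + R f₀ (ψ - ψ₀)`, and both terms are
dominated by products of continuous seminorms. -/
lemma continuous_ridgeletLM [n.AtLeastTwo] :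
    Continuous fun p : lizorkin n × lizorkinLine => ridgeletLM n p.1 p.2 := by
  refine continuous_iff_continuousAt.mpr fun ⟨f₀, ψ₀⟩ =>
    ((withSeminorms_SY n).tendsto_nhds _ _).mpr fun i ε hε => ?_
  obtain ⟨p, q, hp, hq, h⟩ := exists_rho_ridgeletLM_le (n := n) i
  have hlim : Filter.Tendsto (fun x : lizorkin n × lizorkinLine =>
      p (x.1 - f₀) * q x.2 + p f₀ * q (x.2 - ψ₀)) (nhds (f₀, ψ₀)) (nhds 0) := by
    have hc : Continuous fun x : lizorkin n × lizorkinLine =>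
        p (x.1 - f₀) * q x.2 + p f₀ * q (x.2 - ψ₀) :=
      ((hp.comp (continuous_fst.sub continuous_const)).mul (hq.comp continuous_snd)).add
        (continuous_const.mul (hq.comp (continuous_snd.sub continuous_const)))
    simpa using hc.tendsto (f₀, ψ₀)
  filter_upwards [hlim.eventually_lt_const hε] with x hx
  have hsplit : ridgeletLM n x.1 x.2 - ridgeletLM n f₀ ψ₀ =
      ridgeletLM n (x.1 - f₀) x.2 + ridgeletLM n f₀ (x.2 - ψ₀) := by
    rw [map_sub, LinearMap.sub_apply, map_sub]
    abel
  rw [hsplit]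
  exact ((map_add_le_add _ _ _).trans (add_le_add (h _ _) (h _ _))).trans_lt hx

end Ridgelet

end

/-- The ridgelet transform `(f, ψ) ↦ R_ψ f` is a well-defined sesquilinear map from
`S₀(ℝⁿ) × S₀(ℝ)` to `S(Y^{n+1})`, and it is jointly continuous. -/
theorem theorem4p1 (n : ℕ) [n.AtLeastTwo] :
    ∃ R : Ridgelet.lizorkin n →ₗ[ℂ] Ridgelet.lizorkinLine →ₗ⋆[ℂ] Ridgelet.SY n,
      (∀ (f : Ridgelet.lizorkin n) (ψ : Ridgelet.lizorkinLine) (y : Ridgelet.Y n),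
        R f ψ y = Ridgelet.ridgeletTransform ψ.1 f.1 y) ∧
      Continuous fun p : Ridgelet.lizorkin n × Ridgelet.lizorkinLine => R p.1 p.2 :=
  ⟨Ridgelet.ridgeletLM n, fun f ψ y => (Ridgelet.ridgeletTransform_eq f.1 ψ.1 y).symm,
    Ridgelet.continuous_ridgeletLM⟩
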